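/- \textbf{Conventions.} Let $P$ be a non-empty finite set and let $w$ assign to each non-empty $A\subseteq P$ a real number $w(A)\ge 0$ with $w(A)\le w(B)$ whenever $\emptyset\ne A\subseteq B$ (a \emph{weighted simplex}). For $\alpha\in\mathbb R$ let $W_\alpha=\{A : w(A)\le\alpha\}$, a simplicial complex (the stage at $\alpha$). A complex is a set of non-empty subsets of $P$ (faces) closed under non-empty subsets; a face with $k+1$ elements is a $k$-face. The total weight of a set of faces is the sum of their weights. Homology is simplicial homology over a fixed field $\mathbb F$; fix $d\in\mathbb N$. A subcomplex $C\subseteq X$ is \emph{$d$-fitting} in $X$ if $H_i(C)\to H_i(X)$ is an isomorphism for all $0\le i\le d$, and \emph{$d$-spanning} in $X$ if it has the same faces of dimension less than $d$ as $X$. A \emph{$d$-tree} is a complex $C$ of dimension at most $d$ with $H_d(C)=0$ for which $H_{d-1}(C)\to H_{d-1}(\bullet)$ is an isomorphism, where $\bullet$ is a point. Let $T$ be any \emph{minimal spanning $d$-tree}: a $d$-tree which is $d$-spanning in the simplex of all non-empty subsets of $P$ and has minimal total weight among such; let $T_\alpha=\{A\in T: w(A)\le\alpha\}$. A $d$-face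 $K\notin T$ is \emph{critical}; put $\mathrm{birth}(K)=w(K)$. \emph{Death times} are assigned as follows. Going through the values $a$ of $w$ in increasing order, let $\mathrm{Cr}_a=\{K_1,\dots,K_s\}$ be the critical faces of weight at most $a$ with no death time yet. The elements $\sum_j c_j[K_j]$ of the kernel of $H_d(T_a\cup\mathrm{Cr}_a,T_a)\to H_d(W_a,T_a)$ give a linear system of equations $\sum_j c_jx_j=0$. Choose a set $I$ of leading variables (i.e. for arbitrary values of the other variables the system has exactly one solution in the variables of $I$) for which $\{K_j: j\in I\}$ has the largest possible total weight, and put $\mathrm{death}(K_j)=a$ for $j\in I$. Critical faces left over in the end have death time $\infty$. The \emph{homologically persistent skeleton} is $\mathrm{HoPeS}=T\cup\{K\text{ critical}:\mathrm{birth}(K)<\mathrm{death}(K)\}$; a face $A$ is labelled $(w(A),\infty)$ if $A\in T$ and $(\mathrm{birth}(A),\mathrm{death}(A))$ otherwise. The \emph{reduced skeleton} $\mathrm{HoPeS}_\alpha$ consists of the faces of $\mathrm{HoPeS}$ whose label $(l,r)$ satisfies $l\le\alpha<r$. Let $\mathrm{PD}$ be the $d$-dimensional persistence diagram of the filtration $(W_\alpha)_{\alpha\in\mathbb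 R}$, a multiset of dots $(p,q)$ with $p<q\le\infty$; a dot is alive at $\alpha$ if $p\le\alpha<q$. For subcomplexes $G\subseteq C\subseteq W_\alpha$, an \emph{induced correspondence} is a bijection $\varphi$ from the $d$-faces of $C\setminus G$ to the dots of $\mathrm{PD}$ alive at $\alpha$ (counted with multiplicity) for which there are classes $h_S\in H_d(C)$ mapping to $[S]\in H_d(C,G)$ and a decomposition of the persistent homology $H_d(W_\bullet)$ into intervals with one generator for each dot of $\mathrm{PD}$, such that for every $S$ the generator of the dot $\varphi(S)$ occurs with non-zero coefficient in the expansion of the image of $h_S$ in $H_d(W_\alpha)$ in the basis of the generators alive at $\alpha$. \textbf{Theorem.} For every weighted simplex, every field $\mathbb F$, every $d\in\mathbb N$ and $\alpha\in\mathbb R$, and all choices of $T$ and of the death times as above: \begin{enumerate} \item $\mathrm{HoPeS}_\alpha$ is a $d$-spanning subcomplex of $W_\alpha$ of dimension at most $d$, and it is $d$-fitting in $W_\alpha$. \item There is an induced correspondence for $C=\mathrm{HoPeS}_\alpha$ and $G=T_\alpha$ in which the dot of every critical $d$-face $K$ of $\mathrm{HoPeS}_\alpha$ equals the label $(\mathrm{birth}(K),\mathrm{death}(K))$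 of $K$. Moreover, in every induced correspondence for these $C$ and $G$, the dot $(p,q)$ of $K$ satisfies $p=w(K)$. \item $\mathrm{HoPeS}_\alpha$ has minimal total weight among all $d$-fitting $d$-spanning subcomplexes $C\subseteq W_\alpha$. \end{enumerate} -/

import Mathlib

noncomputable section

namespace HomPersSkeleton

/-! ### Finite simplicial complexes

A complex on the finite vertex set `P` is the finite set of its faces, and a face is the set of its
vertices. A face of dimension `k` has `k + 1` vertices. -/

section Complexes

/-- A finite family of faces is a simplicial complex when all its members are non-empty and it
contains every non-empty subset of each of its members. -/
def IsComplex {P : Type*} (X : Finset (Finset P)) : Prop :=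
  IsRelLowerSet (X : Set (Finset P)) Finset.Nonempty

/-- The full simplex on `P`: all non-empty subsets of `P`. -/
def fullSimplex (P : Type*) [Fintype P] : Finset (Finset P) :=
  Finset.univ.filter fun A => A.Nonempty

/-- All faces of `X` have dimension at most `k`. -/
def DimLE {P : Type*} (k : ℕ) (X : Finset (Finset P)) : Prop :=
  ∀ A ∈ X, A.card ≤ k + 1

/-- `C` has the same `(k - 1)`-skeleton as `X`, that is, the same faces with at most `k` vertices. -/
def IsSpanning {P : Type*} (k : ℕ) (C X : Finset (Finset P)) : Prop :=
  ∀ A : Finset P, A.card ≤ k → (A ∈ C ↔ A ∈ X)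

end Complexes

/-! ### Simplicial homology over a field

A linear order on the vertices is used only to fix the orientations of the faces. Chains of all
complexes on `P` live in one vector space, the functions on the set of subsets of `P`; the basis
vector of a face `A` is `Pi.single A 1`. Degrees are integers, so that a complex has no non-zero
chains in negative degrees. -/

section Homology

variable (F : Type*) [Field F] {P : Type*} [Fintype P] [LinearOrder P]

/-- The sign of the vertex `v` in the boundary of `A`: `(-1) ^ i`, where `i` is the position of `v`
in the increasing list of vertices of `A`. -/
def sign (A : Finset P) (v : P) : F := (-1) ^ (A.filter fun u => u < v).card

/-- The boundary operator; the boundary of a vertex is `0`. -/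
def boundary : (Finset P → F) →ₗ[F] (Finset P → F) :=
  Fintype.linearCombination F fun A : Finset P =>
    ∑ v ∈ A, if (A.erase v).Nonempty then Pi.single (A.erase v) (sign F A v) else 0

/-- The space `C_k(X)` of `k`-chains of `X`: the functions supported on the `k`-faces of `X`. -/
def chains (k : ℤ) (X : Finset (Finset P)) : Submodule F (Finset P → F) where
  carrier := {c | ∀ A : Finset P, c A ≠ 0 → A ∈ X ∧ (A.card : ℤ) = k + 1}
  zero_mem' := fun _ h => absurd rfl h
  add_mem' := by
    intro c c' hc hc' A h
    by_cases h0 : c A = 0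
    · exact hc' A fun h1 => h (by simp [h0, h1])
    · exact hc A h0
  smul_mem' := fun r c hc A h => hc A fun h0 => h (by simp [h0])

/-- Relative cycles: `k`-chains of `X` whose boundary is a chain of `A`. -/
def relCycles (k : ℤ) (X A : Finset (Finset P)) : Submodule F (Finset P → F) :=
  chains F k X ⊓ (chains F (k - 1) A).comap (boundary F)

/-- Relative boundaries: boundaries of `(k + 1)`-chains of `X`, up to `k`-chains of `A`. -/
def relBoundaries (k : ℤ) (X A : Finset (Finset P)) : Submodule F (Finset P → F) :=
  (chains F (k + 1) X).map (boundary F) ⊔ chains F k A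

/-- Relative homology `H_k(X, A; F)`: relative cycles modulo relative boundaries. -/
abbrev RelHomology (k : ℤ) (X A : Finset (Finset P)) : Type _ :=
  relCycles F k X A ⧸ (relBoundaries F k X A).submoduleOf (relCycles F k X A)

/-- Homology `H_k(X; F) = H_k(X, ∅; F)`. -/
abbrev Homology (k : ℤ) (X : Finset (Finset P)) : Type _ :=
  RelHomology F k X ∅

variable {F}

theorem chains_mono {k : ℤ} {X Y : Finset (Finset P)} (h : X ⊆ Y) :
    chains F k X ≤ chains F k Y :=
  fun _ hc A hA => ⟨h (hc A hA).1, (hc A hA).2⟩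

theorem relCycles_mono {k : ℤ} {X A Y B : Finset (Finset P)} (h : X ⊆ Y) (h' : A ⊆ B) :
    relCycles F k X A ≤ relCycles F k Y B :=
  inf_le_inf (chains_mono h) (Submodule.comap_mono (chains_mono h'))

theorem relBoundaries_mono {k : ℤ} {X A Y B : Finset (Finset P)} (h : X ⊆ Y) (h' : A ⊆ B) :
    relBoundaries F k X A ≤ relBoundaries F k Y B :=
  sup_le_sup (Submodule.map_mono (chains_mono h)) (chains_mono h')

variable (F)

/-- The map `H_k(X, A) → H_k(Y, B)` induced by the inclusion of pairs `(X, A) ↪ (Y, B)`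
(and, by convention, `0` if `(X, A)` is not contained in `(Y, B)`). -/
def relMap (k : ℤ) (X A Y B : Finset (Finset P)) :
    RelHomology F k X A →ₗ[F] RelHomology F k Y B :=
  if h : X ⊆ Y ∧ A ⊆ B then
    Submodule.mapQ _ _ (Submodule.inclusion (relCycles_mono h.1 h.2))
      (fun _ hz => relBoundaries_mono h.1 h.2 hz)
  else 0

/-- The map `H_k(X) → H_k(Y)` induced by the inclusion `X ↪ Y`. -/
abbrev homMap (k : ℤ) (X Y : Finset (Finset P)) : Homology F k X →ₗ[F] Homology F k Y :=
  relMap F k X ∅ Y ∅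

open Classical in
/-- The class in `H_k(X, A)` of a relative cycle `z` (and, by convention, `0` if `z` is not a
relative cycle). -/
def relClass (k : ℤ) (X A : Finset (Finset P)) (z : Finset P → F) : RelHomology F k X A :=
  if h : z ∈ relCycles F k X A then Submodule.Quotient.mk ⟨z, h⟩ else 0

/-- The class in `H_k(X, A)` represented by a single face `K`. -/
abbrev faceClass (k : ℤ) (X A : Finset (Finset P)) (K : Finset P) : RelHomology F k X A :=
  relClass F k X A (Pi.single K 1)

/-- The chain map induced by the map that sends all vertices to the vertex of a singleton:
vertices go to the vertex, faces of positive dimension go to `0`. -/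
def collapse : (Finset P → F) →ₗ[F] (Finset Unit → F) :=
  Fintype.linearCombination F fun A : Finset P =>
    if A.card = 1 then Pi.single Finset.univ 1 else 0

theorem collapse_boundary (c : Finset P → F) : collapse F (boundary F c) = 0 := by
  have key : ∀ A : Finset P, collapse F (∑ v ∈ A, if (A.erase v).Nonempty then
      Pi.single (A.erase v) (sign F A v) else 0) = 0 := by
    intro A
    by_cases hA : A.card = 2
    · obtain ⟨x, y, hxy, rfl⟩ : ∃ x y : P, x < y ∧ A = {x, y} := by
        obtain ⟨x, y, hne, rfl⟩ := Finset.card_eq_two.mp hA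
        rcases lt_or_gt_of_ne hne with h | h
        · exact ⟨x, y, h, rfl⟩
        · exact ⟨y, x, h, Finset.pair_comm x y⟩
      have h1 : ({x, y} : Finset P).erase x = {y} := by
        ext z; simp only [Finset.mem_erase, Finset.mem_insert, Finset.mem_singleton]
        constructor
        · tauto
        · rintro rfl; exact ⟨hxy.ne', Or.inr rfl⟩
      have h2 : ({x, y} : Finset P).erase y = {x} := by
        ext z; simp only [Finset.mem_erase, Finset.mem_insert, Finset.mem_singleton]
        constructor
        · tauto
        · rintro rfl; exact ⟨hxy.ne, Or.inl rfl⟩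
      have s1 : (({x, y} : Finset P).filter fun u => u < x) = ∅ := by
        ext z; simp only [Finset.mem_filter, Finset.mem_insert, Finset.mem_singleton,
          Finset.notMem_empty, iff_false]
        rintro ⟨rfl | rfl, h⟩
        · exact lt_irrefl _ h
        · exact lt_asymm hxy h
      have s2 : (({x, y} : Finset P).filter fun u => u < y) = {x} := by
        ext z; simp only [Finset.mem_filter, Finset.mem_insert, Finset.mem_singleton]
        constructor
        · rintro ⟨rfl | rfl, h⟩
          · rfl
          · exact absurd h (lt_irrefl _)
        · rintro rfl; exact ⟨Or.inl rfl, hxy⟩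
      rw [Finset.sum_pair hxy.ne, h1, h2]
      simp [sign, s1, s2, collapse, Fintype.linearCombination_apply_single]
    · rw [map_sum]
      refine Finset.sum_eq_zero fun v hv => ?_
      have hc : (A.erase v).card ≠ 1 := by
        rw [Finset.card_erase_of_mem hv]; omega
      split_ifs
      · simp [collapse, Fintype.linearCombination_apply_single, hc]
      · simp
  rw [boundary, Fintype.linearCombination_apply, map_sum]
  refine Finset.sum_eq_zero fun A _ => ?_
  rw [map_smul, key, smul_zero]

theorem collapse_mem_relCycles (k : ℤ) {X : Finset (Finset P)} {z : Finset P → F}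
    (hz : z ∈ relCycles F k X ∅) : collapse F z ∈ relCycles F k (fullSimplex Unit) ∅ := by
  have hs : collapse F z ∈ chains F k (fullSimplex Unit) := by
    rw [collapse, Fintype.linearCombination_apply]
    refine Submodule.sum_mem _ fun A _ => ?_
    by_cases hA : z A = 0
    · rw [hA, zero_smul]
      exact Submodule.zero_mem _
    refine Submodule.smul_mem _ _ ?_
    have hAX := hz.1 A hA
    split_ifs with h1
    · intro B hB
      have hBu : B = Finset.univ := by
        by_contra h
        exact hB (Pi.single_eq_of_ne h 1)
      rw [h1] at hAX
      subst hBu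
      exact ⟨by simp [fullSimplex], by simpa using hAX.2⟩
    · exact Submodule.zero_mem _
  have hb : boundary F (collapse F z) = 0 := by
    rw [collapse, Fintype.linearCombination_apply, map_sum]
    refine Finset.sum_eq_zero fun A _ => ?_
    rw [map_smul]
    split_ifs
    · simp [boundary, Fintype.linearCombination_apply_single]
    · simp
  refine Submodule.mem_inf.mpr ⟨hs, ?_⟩
  rw [Submodule.mem_comap, hb]
  exact Submodule.zero_mem _

/-- The map `H_k(X) → H_k(•)` induced by the unique map from `X` to a singleton. -/
def toPoint (k : ℤ) (X : Finset (Finset P)) :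
    Homology F k X →ₗ[F] Homology F k (fullSimplex Unit) :=
  Submodule.mapQ _ _
    ((collapse F).restrict (p := relCycles F k X ∅) (q := relCycles F k (fullSimplex Unit) ∅)
      fun _ hz => collapse_mem_relCycles F k hz)
    (by
      rintro ⟨z, hz⟩ hzb
      change collapse F z ∈ relBoundaries F k (fullSimplex Unit) ∅
      change z ∈ relBoundaries F k X ∅ at hzb
      obtain ⟨y, ⟨c, -, rfl⟩, e, he, rfl⟩ := Submodule.mem_sup.mp hzb
      have he0 : e = 0 := by
        funext A
        by_contra hA
        exact absurd (he A hA).1 (Finset.notMem_empty A)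
      rw [he0, add_zero, collapse_boundary]
      exact Submodule.zero_mem _)

/-- `C` is `k`-fitting in `X`: the inclusion induces isomorphisms in homology in all degrees
`i ≤ k`. -/
def IsFitting (k : ℕ) (C X : Finset (Finset P)) : Prop :=
  C ⊆ X ∧ ∀ i : ℕ, i ≤ k → Function.Bijective (homMap F (i : ℤ) C X)

/-- A `k`-forest: a complex of dimension at most `k` with `H_k = 0`. -/
def IsForest (k : ℕ) (C : Finset (Finset P)) : Prop :=
  IsComplex C ∧ DimLE k C ∧ Subsingleton (Homology F (k : ℤ) C)

/-- A `k`-tree: a `k`-forest `C` for which `H_{k-1}(C) → H_{k-1}(•)` is an isomorphism. -/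
def IsTree (k : ℕ) (C : Finset (Finset P)) : Prop :=
  IsForest F k C ∧ Function.Bijective (toPoint F ((k : ℤ) - 1) C)

end Homology

/-! ### Weighted simplices and their filtrations -/

/-- A weighting on `P`: a non-negative monotone function on the non-empty subsets of `P`
(the value at the empty set plays no role). -/
structure Weighting (P : Type*) where
  weight : Finset P → ℝ
  nonneg : ∀ A : Finset P, A.Nonempty → 0 ≤ weight A
  mono : ∀ A B : Finset P, A.Nonempty → A ⊆ B → weight A ≤ weight B

section Filtration

variable {P : Type*}

/-- The total weight of a family of faces. -/
def Weighting.total (w : Weighting P) (S : Finset (Finset P)) : ℝ := ∑ A ∈ S, w.weight A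

variable [Fintype P]

/-- The subset of faces of `S` of weight at most `a`. -/
def Weighting.reduced (w : Weighting P) (S : Finset (Finset P)) (a : ℝ) : Finset (Finset P) :=
  S.filter fun A => w.weight A ≤ a

/-- The stage at scale `a`: all faces of weight at most `a`. -/
def Weighting.stage (w : Weighting P) (a : ℝ) : Finset (Finset P) :=
  w.reduced (fullSimplex P) a

/-- The stage just before `a`: all faces of weight less than `a`. -/
def Weighting.stageBefore (w : Weighting P) (a : ℝ) : Finset (Finset P) :=
  (fullSimplex P).filter fun A => w.weight A < a

/-- The image of the weighting, i.e. the finite set of all weights of faces. -/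
def Weighting.values (w : Weighting P) : Finset ℝ := (fullSimplex P).image w.weight

variable (F : Type*) [Field F] [LinearOrder P]

/-- A minimal spanning `d`-tree: a spanning `d`-tree of the simplex of minimal total weight. -/
def IsMinSpanningTree (w : Weighting P) (d : ℕ) (T : Finset (Finset P)) : Prop :=
  (IsTree F d T ∧ IsSpanning d T (fullSimplex P)) ∧
    ∀ T' : Finset (Finset P), IsTree F d T' → IsSpanning d T' (fullSimplex P) →
      w.total T ≤ w.total T'

end Filtration

/-! ### The persistence diagram -/

section Persistence

variable (F : Type*) [Field F] {P : Type*} [Fintype P] [LinearOrder P]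

/-- The rank of the map `H_d(X) → H_d(Y)` induced by the inclusion. -/
def rank (d : ℕ) (X Y : Finset (Finset P)) : ℕ :=
  Module.finrank F (LinearMap.range (homMap F (d : ℤ) X Y))

/-- The multiplicity of the dot `(p, q)`, `p < q < ∞`, in the persistence diagram: the number of
independent `d`-dimensional classes which are born at `p` and die at `q`. -/
def dotMult (w : Weighting P) (d : ℕ) (p q : ℝ) : ℕ :=
  ((((rank F d (w.stage p) (w.stageBefore q) : ℤ) - rank F d (w.stage p) (w.stage q)) -
    ((rank F d (w.stageBefore p) (w.stageBefore q) : ℤ) -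
      rank F d (w.stageBefore p) (w.stage q)))).toNat

/-- The multiplicity of the dot `(p, ∞)`: the number of independent `d`-dimensional classes which
are born at `p` and never die. -/
def dotMultTop (w : Weighting P) (d : ℕ) (p : ℝ) : ℕ :=
  ((rank F d (w.stage p) (fullSimplex P) : ℤ) -
    rank F d (w.stageBefore p) (fullSimplex P)).toNat

/-- The `d`-dimensional persistence diagram of the filtration by the stages of the weighted simplex:
the multiset of dots `(p, q)`, with `p < q ≤ ∞`. -/
def diagram (w : Weighting P) (d : ℕ) : Multiset (EReal × EReal) :=
  ∑ p ∈ w.values,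
    ((∑ q ∈ w.values.filter (fun q => p < q),
        Multiset.replicate (dotMult F w d p q) ((p : EReal), (q : EReal))) +
      Multiset.replicate (dotMultTop F w d p) ((p : EReal), (⊤ : EReal)))

/-- The dots of the persistence diagram, with multiplicity: a dot of multiplicity `m` gives `m`
elements of this type, each of which coerces to the pair `(p, q)`. -/
abbrev Dot (w : Weighting P) (d : ℕ) : Type := (diagram F w d).ToType

/-- The dot `(p, q)` is alive at `t`: `p ≤ t < q`. -/
def AliveAt (x : EReal × EReal) (t : ℝ) : Prop := x.1 ≤ (t : EReal) ∧ (t : EReal) < x.2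

/-- A decomposition of the persistent homology `H_d` of the filtration into intervals indexed by
the dots of the diagram. To the dot `x = (p, q)` belong classes `gen x t ∈ H_d(stage t)`, which
vanish unless `p ≤ t < q` and are mapped to each other by the inclusions from `p` on; at every scale
the classes of the dots that are alive form a basis. -/
structure IsIntervalDecomposition (w : Weighting P) (d : ℕ)
    (gen : Dot F w d → (t : ℝ) → Homology F (d : ℤ) (w.stage t)) : Prop where
  eq_zero : ∀ (x : Dot F w d) (t : ℝ), ¬ AliveAt x.1 t → gen x t = 0
  map_eq : ∀ (x : Dot F w d) (s t : ℝ), x.1.1 ≤ (s : EReal) → s ≤ t →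
    homMap F (d : ℤ) (w.stage s) (w.stage t) (gen x s) = gen x t
  linearIndependent : ∀ t : ℝ,
    LinearIndependent F fun x : {x : Dot F w d // AliveAt x.1 t} => gen x.1 t
  span_eq_top : ∀ t : ℝ,
    Submodule.span F (Set.range fun x : {x : Dot F w d // AliveAt x.1 t} => gen x.1 t) = ⊤

/-- The `d`-faces of `C` which are not in `G`. -/
def facesOff (d : ℕ) (C G : Finset (Finset P)) : Finset (Finset P) :=
  C.filter fun S => S.card = d + 1 ∧ S ∉ G

/-- A bijective correspondence between the `d`-faces of `C ∖ G` and the dots alive at `a`, where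
`G ⊆ C ⊆ stage a`, induced by the isomorphisms
`f : H_d(C, G) ← H_d(C) → H_d(stage a)`. The class `[S] ∈ H_d(C, G)` of a face `S` lifts to a class
`lift S ∈ H_d(C)`, whose image in `H_d(stage a)` is `f [S]`. The basis of the classes `f [S]` is
matched with the dots through an interval decomposition: the generator of the dot of `S` occurs
with a non-zero coefficient in the expansion of `f [S]`. -/
structure DotCorrespondence (w : Weighting P) (d : ℕ) (a : ℝ) (C G : Finset (Finset P)) where
  /-- the bijection -/
  dot : {S // S ∈ facesOff d C G} ≃ {x : Dot F w d // AliveAt x.1 a}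
  /-- the preimages of the classes `[S]` in `H_d(C)` -/
  lift : {S // S ∈ facesOff d C G} → Homology F (d : ℤ) C
  lift_spec : ∀ S, relMap F (d : ℤ) C ∅ C G (lift S) = faceClass F (d : ℤ) C G S.1
  /-- the generators of the interval decomposition -/
  gen : Dot F w d → (t : ℝ) → Homology F (d : ℤ) (w.stage t)
  isDecomposition : IsIntervalDecomposition F w d gen
  coeff_ne_zero : ∀ S, homMap F (d : ℤ) C (w.stage a) (lift S) ∉
    Submodule.span F ((fun x : {x : Dot F w d // AliveAt x.1 a} => gen x.1 a) '' {x | x ≠ dot S})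

end Persistence

/-! ### Critical faces, their deaths, and the homologically persistent skeleton -/

section Skeleton

variable (F : Type*) [Field F] {P : Type*} [Fintype P] [LinearOrder P]

/-- The critical `d`-faces: the `d`-faces of the simplex which are not in the tree `T`. -/
def critical (d : ℕ) (T : Finset (Finset P)) : Finset (Finset P) :=
  facesOff d (fullSimplex P) T

/-- For a set `Cr` of critical faces of weight at most `a`: `x` solves the linear system
`∑ c_K x_K = 0`, whose equations are given by the elements `∑ c_K [K]` of the kernel of
`H_d(T_a ∪ Cr, T_a) → H_d(stage a, T_a)`. (A basis of the kernel gives an equivalent system.) -/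
def Solves (w : Weighting P) (d : ℕ) (T : Finset (Finset P)) (a : ℝ) (Cr : Finset (Finset P))
    (x : {K // K ∈ Cr} → F) : Prop :=
  ∀ c : {K // K ∈ Cr} → F,
    ∑ K, c K • faceClass F (d : ℤ) (w.reduced T a ∪ Cr) (w.reduced T a) K.1 ∈
        LinearMap.ker (relMap F (d : ℤ) (w.reduced T a ∪ Cr) (w.reduced T a)
          (w.stage a) (w.reduced T a)) →
      ∑ K, c K * x K = 0

/-- `I ⊆ Cr` is a possible set of leading variables of the system: for arbitrary values of the other
variables, the system has exactly one solution in the variables of `I`. -/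
def IsLeading (w : Weighting P) (d : ℕ) (T : Finset (Finset P)) (a : ℝ)
    (Cr I : Finset (Finset P)) : Prop :=
  I ⊆ Cr ∧ ∀ y : {K // K ∈ Cr} → F,
    ∃! x : {K // K ∈ Cr} → F, Solves F w d T a Cr x ∧ ∀ K, K.1 ∉ I → x K = y K

/-- The critical faces born at or before `a` which have not been assigned a death time below `a`. -/
def pending (w : Weighting P) (d : ℕ) (T : Finset (Finset P)) (death : Finset P → EReal) (a : ℝ) :
    Finset (Finset P) :=
  (critical d T).filter fun K => w.weight K ≤ a ∧ (a : EReal) ≤ death K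

/-- The critical faces whose death time is `a`. -/
def dying (d : ℕ) (T : Finset (Finset P)) (death : Finset P → EReal) (a : ℝ) :
    Finset (Finset P) :=
  (critical d T).filter fun K => death K = (a : EReal)

/-- `death` is a possible assignment of death times to the critical `d`-faces: the faces which die
at a value `a` of the weighting form a set of leading variables for the set of faces pending at `a`,
of maximal total weight among all such sets (elder rule); a face which never dies has death time
`∞`. (The values of `death` off the critical faces play no role.) -/
structure IsDeathAssignment (w : Weighting P) (d : ℕ) (T : Finset (Finset P))
    (death : Finset P → EReal) : Prop where
  range : ∀ K ∈ critical d T,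
    death K = ⊤ ∨ ∃ a ∈ w.values, w.weight K ≤ a ∧ death K = (a : EReal)
  leading : ∀ a ∈ w.values,
    IsLeading F w d T a (pending w d T death a) (dying d T death a)
  elder : ∀ a ∈ w.values, ∀ I : Finset (Finset P),
    IsLeading F w d T a (pending w d T death a) I → w.total I ≤ w.total (dying d T death a)

/-- The label of a face: `(weight, ∞)` in the tree, and `(birth, death)` for a critical face, whose
birth time is its weight. -/
def label (w : Weighting P) (T : Finset (Finset P)) (death : Finset P → EReal) (A : Finset P) :
    EReal × EReal :=
  if A ∈ T then ((w.weight A : EReal), ⊤) else ((w.weight A : EReal), death A)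

/-- The homologically persistent `d`-skeleton: the tree and all critical faces of positive
lifespan. -/
def skeleton (w : Weighting P) (d : ℕ) (T : Finset (Finset P)) (death : Finset P → EReal) :
    Finset (Finset P) :=
  T ∪ (critical d T).filter fun K => (w.weight K : EReal) < death K

open Classical in
/-- The reduced skeleton at scale `a`: the faces whose label `(l, r)` satisfies `l ≤ a < r`. -/
def reducedSkeleton (w : Weighting P) (d : ℕ) (T : Finset (Finset P)) (death : Finset P → EReal)
    (a : ℝ) : Finset (Finset P) :=
  (skeleton w d T death).filter fun A => AliveAt (label w T death A) a

end Skeleton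

end HomPersSkeleton

end

set_option linter.unusedSectionVars false

namespace HomPersSkeleton

/-! ### Chain-level descriptions of homology and of induced maps -/

section Chains

variable {F : Type*} [Field F] {P : Type*} [Fintype P] [LinearOrder P]

/-! The spanning tree `T` turns persistent homology into linear algebra on functions on the critical
faces. As `T` contains every face of dimension below `d` and `H_{d-1}(T)` is that of a point, the
boundary of each `d`-face `K` is the boundary of a chain of `T`; as `H_d(T) = 0`, that chain is
unique. A `d`-cycle is therefore determined by its coefficients at the critical faces, and these are
arbitrary (`critCycle`, `critCoeffs`). If a face `t` of the tree chain of `K` were heavier than `K`,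
exchanging `t` for `K` would give a lighter tree, so the cycle of `K` already lies in the stage at
`w(K)`. Hence the `d`-cycles of the stage at `t` are exactly the functions supported on critical
faces of weight at most `t`, and its `d`-boundaries form an increasing family of subspaces `B_t`
(`critBoundaries`).

A set of leading variables is a set of coordinates onto which the solution-defining space projects
isomorphically. So each `K` dying at `a` yields a vector of `B_a` with coefficient `1` at `K` whose
other entries are at faces dying later; by basis exchange and the elder rule those entries weigh at
most `w(K)`. With the unit vectors of the immortal faces, these vectors form a basis that is
unitriangular for death times, and both filtrations are spanned by parts of it: weight at most `t`
for the cycles, death at most `t` for `B_t` (`exists_adapted_coordinates`, `IsAdapted`). Each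
critical face thus contributes the interval from its weight to its death. Counting ranks identifies
the diagram with the labels of positive length (`diagram_eq`), and the dual coordinates give
generators.

The cycles of the reduced skeleton at `α` are the functions supported on the faces alive at `α`, a
complement of `B_α` in the cycles of the stage; this is the fitting property in degree `d`. In lower
degrees a `d`-face can be replaced by its tree chain.

For births, the class attached to `K` comes from the stage at `w(K)`, so only dots born by then
occur in its expansion. This bounds the birth of any corresponding dot by `w(K)`, and comparing
total births with the correspondence by labels forces equality.

For minimality, a projection that kills the boundaries of the stage at `α`, fixes the `d`-faces of
the skeleton and preserves every stage sends the `d`-chains of a competitor onto those of the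
skeleton. Hall's marriage theorem then matches each `d`-face of the skeleton with its own `d`-face
of the competitor that is at least as heavy. -/

theorem boundary_single (A : Finset P) :
    boundary F (Pi.single A 1) =
      ∑ v ∈ A, if (A.erase v).Nonempty then Pi.single (A.erase v) (sign F A v) else 0 := by
  simp [boundary, Fintype.linearCombination_apply_single]

theorem single_mem_chains {k : ℤ} {X : Finset (Finset P)} {A : Finset P} (hA : A ∈ X)
    (hc : (A.card : ℤ) = k + 1) (r : F) : Pi.single A r ∈ chains F k X := by
  intro B hB
  obtain rfl : B = A := by
    by_contra h
    exact hB (Pi.single_eq_of_ne (M := fun _ => F) h r)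
  exact ⟨hA, hc⟩

theorem apply_eq_zero_of_mem_chains {k : ℤ} {X : Finset (Finset P)} {c : Finset P → F}
    (hc : c ∈ chains F k X) {A : Finset P} (hA : A ∉ X) : c A = 0 := by
  by_contra h
  exact hA (hc A h).1

theorem linearMap_apply_eq_sum {M : Type*} [AddCommGroup M] [Module F M] {κ : Type*} [Fintype κ]
    [DecidableEq κ] (f : (κ → F) →ₗ[F] M) (c : κ → F) :
    f c = ∑ A, c A • f (Pi.single A 1) := by
  conv_lhs => rw [← Finset.univ_sum_single c, map_sum]
  refine Finset.sum_congr rfl fun A _ => ?_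
  rw [← map_smul, ← Pi.single_smul, smul_eq_mul, mul_one]

theorem map_mem_of_forall_single {M : Type*} [AddCommGroup M] [Module F M] {κ : Type*} [Fintype κ]
    [DecidableEq κ] (f : (κ → F) →ₗ[F] M) (N : Submodule F M) {c : κ → F}
    (h : ∀ A, c A ≠ 0 → f (Pi.single A 1) ∈ N) : f c ∈ N := by
  rw [linearMap_apply_eq_sum]
  refine Submodule.sum_mem _ fun A _ => ?_
  by_cases hA : c A = 0
  · simp [hA]
  · exact Submodule.smul_mem _ _ (h A hA)

theorem boundary_mem_chains_of {k : ℤ} {X Y : Finset (Finset P)}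
    (h : ∀ A ∈ X, (A.card : ℤ) = k + 1 → ∀ v ∈ A, (A.erase v).Nonempty → A.erase v ∈ Y)
    {c : Finset P → F} (hc : c ∈ chains F k X) : boundary F c ∈ chains F (k - 1) Y := by
  refine map_mem_of_forall_single (boundary F) _ fun A hA => ?_
  rw [boundary_single]
  refine Submodule.sum_mem _ fun v hv => ?_
  split_ifs with hne
  · refine single_mem_chains (h A (hc A hA).1 (hc A hA).2 v hv hne) ?_ _
    have h1 := Finset.card_erase_add_one hv
    have h2 := (hc A hA).2
    omega
  · exact Submodule.zero_mem _

theorem boundary_mem_chains {k : ℤ} {X : Finset (Finset P)} (hX : IsComplex X)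
    {c : Finset P → F} (hc : c ∈ chains F k X) : boundary F c ∈ chains F (k - 1) X :=
  boundary_mem_chains_of (fun _ hA _ v _ hne => (hX hA).2 (Finset.erase_subset v _) hne) hc

/-- Deleting `u < v` lowers the position of `v` by one, while deleting `v` leaves the position of
`u` unchanged; so the two orders of deletion carry opposite signs. -/
theorem sign_mul_sign_erase (A : Finset P) {u v : P} (hu : u ∈ A) (huv : u < v) :
    sign F A v * sign F (A.erase v) u + sign F A u * sign F (A.erase u) v = 0 := by
  have h1 : (A.erase v).filter (fun x => x < u) = A.filter fun x => x < u := by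
    ext x
    simp only [Finset.mem_filter, Finset.mem_erase]
    exact ⟨fun h => ⟨h.1.2, h.2⟩, fun h => ⟨⟨(h.2.trans huv).ne, h.1⟩, h.2⟩⟩
  have h2 : (A.erase u).filter (fun x => x < v) = (A.filter fun x => x < v).erase u := by
    ext x
    simp only [Finset.mem_filter, Finset.mem_erase]
    tauto
  have h3 : u ∈ A.filter fun x => x < v := Finset.mem_filter.mpr ⟨hu, huv⟩
  simp only [sign, h1, h2]
  rw [← Finset.card_erase_add_one h3, pow_succ]
  ring

theorem boundary_boundary (c : Finset P → F) : boundary F (boundary F c) = 0 := by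
  rw [← Submodule.mem_bot F, ← LinearMap.comp_apply]
  refine map_mem_of_forall_single _ _ fun A _ => ?_
  rw [Submodule.mem_bot, LinearMap.comp_apply, boundary_single, map_sum]
  set g : P → P → (Finset P → F) := fun v u =>
    if ((A.erase v).erase u).Nonempty then
      Pi.single ((A.erase v).erase u) (sign F A v * sign F (A.erase v) u) else 0 with hg
  have h1 : ∀ v ∈ A, boundary F (if (A.erase v).Nonempty then
      Pi.single (A.erase v) (sign F A v) else 0) = ∑ u ∈ A.erase v, g v u := by
    intro v _
    split_ifs with h
    · have : (Pi.single (A.erase v) (sign F A v) : Finset P → F) =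
          sign F A v • Pi.single (A.erase v) 1 := by
        rw [← Pi.single_smul, smul_eq_mul, mul_one]
      rw [this, map_smul, boundary_single, Finset.smul_sum]
      refine Finset.sum_congr rfl fun u _ => ?_
      simp only [hg]
      split_ifs
      · rw [← Pi.single_smul, smul_eq_mul]
      · simp
    · rw [Finset.not_nonempty_iff_eq_empty.mp h]
      simp
  rw [Finset.sum_congr rfl h1, Finset.sum_sigma']
  -- Each codimension-two face arises from two ordered pairs of deleted vertices, whose terms
  -- cancel.
  refine Finset.sum_involution (fun x _ => ⟨x.2, x.1⟩) ?_ ?_ ?_ ?_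
  · rintro ⟨v, u⟩ hx
    simp only [Finset.mem_sigma, Finset.mem_erase] at hx
    have hs : sign F A v * sign F (A.erase v) u + sign F A u * sign F (A.erase u) v = 0 := by
      rcases lt_or_gt_of_ne hx.2.1 with h | h
      · exact sign_mul_sign_erase A hx.2.2 h
      · rw [add_comm]
        exact sign_mul_sign_erase A hx.1 h
    simp only [hg, Finset.erase_right_comm (a := u) (b := v)]
    split_ifs
    · rw [← Pi.single_add, hs, Pi.single_zero]
    · simp
  · rintro ⟨v, u⟩ hx _ h
    simp only [Finset.mem_sigma, Finset.mem_erase] at hx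
    simp only [Sigma.mk.injEq, heq_eq_eq] at h
    exact hx.2.1 h.1
  · rintro ⟨v, u⟩ hx
    simp only [Finset.mem_sigma, Finset.mem_erase] at hx ⊢
    exact ⟨hx.2.2, hx.2.1.symm, hx.1⟩
  · rintro ⟨v, u⟩ _
    rfl

theorem chains_eq_bot {k : ℤ} {X : Finset (Finset P)} (h : ∀ A ∈ X, (A.card : ℤ) ≠ k + 1) :
    chains F k X = ⊥ := by
  refine (Submodule.eq_bot_iff _).mpr fun c hc => funext fun A => ?_
  by_contra hA
  exact h A (hc A hA).1 (hc A hA).2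

theorem chains_empty (k : ℤ) : chains F k (∅ : Finset (Finset P)) = ⊥ :=
  chains_eq_bot fun _ h => absurd h (Finset.notMem_empty _)

theorem mem_relCycles_empty {k : ℤ} {X : Finset (Finset P)} {z : Finset P → F} :
    z ∈ relCycles F k X ∅ ↔ z ∈ chains F k X ∧ boundary F z = 0 := by
  simp [relCycles, chains_empty, Submodule.mem_inf]

theorem mem_relBoundaries {k : ℤ} {X A : Finset (Finset P)} {z : Finset P → F} :
    z ∈ relBoundaries F k X A ↔
      ∃ c ∈ chains F (k + 1) X, z - boundary F c ∈ chains F k A := by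
  constructor
  · intro h
    obtain ⟨_, ⟨c, hc, rfl⟩, e, he, rfl⟩ := Submodule.mem_sup.mp h
    exact ⟨c, hc, by simpa using he⟩
  · rintro ⟨c, hc, h⟩
    exact Submodule.mem_sup.mpr ⟨_, ⟨c, hc, rfl⟩, _, h, by simp⟩

theorem mem_relBoundaries_empty {k : ℤ} {X : Finset (Finset P)} {z : Finset P → F} :
    z ∈ relBoundaries F k X ∅ ↔ ∃ c ∈ chains F (k + 1) X, boundary F c = z := by
  simp only [mem_relBoundaries, chains_empty, Submodule.mem_bot, sub_eq_zero, eq_comm (a := z)]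

theorem relClass_eq_mk {k : ℤ} {X A : Finset (Finset P)} {z : Finset P → F}
    (hz : z ∈ relCycles F k X A) : relClass F k X A z = Submodule.Quotient.mk ⟨z, hz⟩ :=
  dif_pos hz

theorem exists_relClass_eq {k : ℤ} {X A : Finset (Finset P)} (h : RelHomology F k X A) :
    ∃ z ∈ relCycles F k X A, relClass F k X A z = h := by
  obtain ⟨⟨z, hz⟩, rfl⟩ := Submodule.Quotient.mk_surjective _ h
  exact ⟨z, hz, relClass_eq_mk hz⟩

theorem relClass_eq_relClass_iff {k : ℤ} {X A : Finset (Finset P)} {z z' : Finset P → F}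
    (hz : z ∈ relCycles F k X A) (hz' : z' ∈ relCycles F k X A) :
    relClass F k X A z = relClass F k X A z' ↔ z - z' ∈ relBoundaries F k X A := by
  rw [relClass_eq_mk hz, relClass_eq_mk hz', Submodule.Quotient.eq]
  rfl

theorem relClass_eq_zero_iff {k : ℤ} {X A : Finset (Finset P)} {z : Finset P → F}
    (hz : z ∈ relCycles F k X A) :
    relClass F k X A z = 0 ↔ z ∈ relBoundaries F k X A := by
  rw [relClass_eq_mk hz, Submodule.Quotient.mk_eq_zero]
  rfl

theorem relMap_relClass {k : ℤ} {X A Y B : Finset (Finset P)} (h : X ⊆ Y) (h' : A ⊆ B)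
    {z : Finset P → F} (hz : z ∈ relCycles F k X A) :
    relMap F k X A Y B (relClass F k X A z) = relClass F k Y B z := by
  rw [relClass_eq_mk hz, relClass_eq_mk (relCycles_mono h h' hz), relMap, dif_pos ⟨h, h'⟩]
  rfl

theorem sum_smul_relClass {κ : Type*} [Fintype κ] {k : ℤ} {X A : Finset (Finset P)}
    (c : κ → F) (z : κ → Finset P → F) (hz : ∀ i, z i ∈ relCycles F k X A) :
    ∑ i, c i • relClass F k X A (z i) = relClass F k X A (∑ i, c i • z i) := by
  have hs : ∑ i, c i • z i ∈ relCycles F k X A :=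
    Submodule.sum_mem _ fun i _ => Submodule.smul_mem _ _ (hz i)
  rw [relClass_eq_mk hs]
  have : (⟨∑ i, c i • z i, hs⟩ : relCycles F k X A) = ∑ i, c i • ⟨z i, hz i⟩ := by
    ext1
    simp
  rw [this, ← Submodule.mkQ_apply, map_sum]
  refine Finset.sum_congr rfl fun i _ => ?_
  rw [map_smul, relClass_eq_mk (hz i), Submodule.mkQ_apply]

theorem homMap_injective_iff {k : ℤ} {C X : Finset (Finset P)} (h : C ⊆ X) :
    Function.Injective (homMap F k C X) ↔
      ∀ z ∈ chains F k C, boundary F z = 0 → (∃ c ∈ chains F (k + 1) X, boundary F c = z) →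
        ∃ c ∈ chains F (k + 1) C, boundary F c = z := by
  rw [injective_iff_map_eq_zero]
  constructor
  · intro H z hz hz0 hb
    have hzc : z ∈ relCycles F k C ∅ := mem_relCycles_empty.mpr ⟨hz, hz0⟩
    have := H (relClass F k C ∅ z) (by
      rw [homMap, relMap_relClass h subset_rfl hzc,
        relClass_eq_zero_iff (relCycles_mono h subset_rfl hzc)]
      exact mem_relBoundaries_empty.mpr hb)
    exact mem_relBoundaries_empty.mp ((relClass_eq_zero_iff hzc).mp this)
  · intro H x hx
    obtain ⟨z, hz, rfl⟩ := exists_relClass_eq x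
    rw [homMap, relMap_relClass h subset_rfl hz,
      relClass_eq_zero_iff (relCycles_mono h subset_rfl hz), mem_relBoundaries_empty] at hx
    rw [relClass_eq_zero_iff hz, mem_relBoundaries_empty]
    have := mem_relCycles_empty.mp hz
    exact H z this.1 this.2 hx

theorem homMap_surjective_iff {k : ℤ} {C X : Finset (Finset P)} (h : C ⊆ X) :
    Function.Surjective (homMap F k C X) ↔
      ∀ z ∈ chains F k X, boundary F z = 0 → ∃ z' ∈ chains F k C, boundary F z' = 0 ∧
        ∃ c ∈ chains F (k + 1) X, boundary F c = z - z' := by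
  constructor
  · intro H z hz hz0
    have hzc : z ∈ relCycles F k X ∅ := mem_relCycles_empty.mpr ⟨hz, hz0⟩
    obtain ⟨x, hx⟩ := H (relClass F k X ∅ z)
    obtain ⟨z', hz', rfl⟩ := exists_relClass_eq x
    rw [homMap, relMap_relClass h subset_rfl hz', eq_comm,
      relClass_eq_relClass_iff hzc (relCycles_mono h subset_rfl hz'),
      mem_relBoundaries_empty] at hx
    have := mem_relCycles_empty.mp hz'
    exact ⟨z', this.1, this.2, hx⟩
  · intro H x
    obtain ⟨z, hz, rfl⟩ := exists_relClass_eq x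
    have := mem_relCycles_empty.mp hz
    obtain ⟨z', hz', hz0, hb⟩ := H z this.1 this.2
    have hzc : z' ∈ relCycles F k C ∅ := mem_relCycles_empty.mpr ⟨hz', hz0⟩
    refine ⟨relClass F k C ∅ z', ?_⟩
    rw [homMap, relMap_relClass h subset_rfl hzc, eq_comm,
      relClass_eq_relClass_iff hz (relCycles_mono h subset_rfl hzc)]
    exact mem_relBoundaries_empty.mpr hb

theorem toPoint_relClass {k : ℤ} {X : Finset (Finset P)} {z : Finset P → F}
    (hz : z ∈ relCycles F k X ∅) :
    toPoint F k X (relClass F k X ∅ z) =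
      relClass F k (fullSimplex Unit) ∅ (collapse F z) := by
  rw [relClass_eq_mk hz, relClass_eq_mk (collapse_mem_relCycles F k hz)]
  rfl

theorem toPoint_bijective_iff {k : ℤ} {X : Finset (Finset P)} :
    Function.Bijective (toPoint F k X) ↔
      (∀ z ∈ relCycles F k X ∅, collapse F z ∈ relBoundaries F k (fullSimplex Unit) ∅ →
        z ∈ relBoundaries F k X ∅) ∧
      ∀ y ∈ relCycles F k (fullSimplex Unit) ∅, ∃ z ∈ relCycles F k X ∅,
        collapse F z - y ∈ relBoundaries F k (fullSimplex Unit) ∅ := by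
  refine and_congr ?_ ?_
  · rw [injective_iff_map_eq_zero]
    constructor
    · intro H z hz hzb
      rw [← relClass_eq_zero_iff hz]
      apply H
      rwa [toPoint_relClass hz, relClass_eq_zero_iff (collapse_mem_relCycles F k hz)]
    · intro H x hx
      obtain ⟨z, hz, rfl⟩ := exists_relClass_eq x
      rw [toPoint_relClass hz, relClass_eq_zero_iff (collapse_mem_relCycles F k hz)] at hx
      exact (relClass_eq_zero_iff hz).mpr (H z hz hx)
  · constructor
    · intro H y hy
      obtain ⟨x, hx⟩ := H (relClass F k _ ∅ y)
      obtain ⟨z, hz, rfl⟩ := exists_relClass_eq x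
      rw [toPoint_relClass hz,
        relClass_eq_relClass_iff (collapse_mem_relCycles F k hz) hy] at hx
      exact ⟨z, hz, hx⟩
    · intro H x
      obtain ⟨y, hy, rfl⟩ := exists_relClass_eq x
      obtain ⟨z, hz, h⟩ := H y hy
      refine ⟨relClass F k X ∅ z, ?_⟩
      rwa [toPoint_relClass hz, relClass_eq_relClass_iff (collapse_mem_relCycles F k hz) hy]

/-- In top dimension there are no non-zero boundaries, so homology is the space of cycles. -/
theorem subsingleton_homology_iff {k : ℕ} {C : Finset (Finset P)} (hC : DimLE k C) :
    Subsingleton (Homology F (k : ℤ) C) ↔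
      ∀ z ∈ chains F (k : ℤ) C, boundary F z = 0 → z = 0 := by
  have h0 : chains F ((k : ℤ) + 1) C = ⊥ := chains_eq_bot fun A hA h => by
    have := hC A hA
    omega
  constructor
  · intro H z hz hz0
    have hzc : z ∈ relCycles F (k : ℤ) C ∅ := mem_relCycles_empty.mpr ⟨hz, hz0⟩
    have := (relClass_eq_zero_iff hzc).mp (Subsingleton.elim _ _)
    obtain ⟨c, hc, rfl⟩ := mem_relBoundaries_empty.mp this
    rw [h0, Submodule.mem_bot] at hc
    rw [hc, map_zero]
  · intro H
    refine subsingleton_of_forall_eq 0 fun x => ?_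
    obtain ⟨z, hz, rfl⟩ := exists_relClass_eq x
    have h := mem_relCycles_empty.mp hz
    rw [relClass_eq_zero_iff hz, H z h.1 h.2]
    exact Submodule.zero_mem _

end Chains

/-! ### Leading variables, basis exchange, and bases adapted to two filtrations -/

section LinearSystems

variable {F κ : Type*} [Field F] [Fintype κ] [DecidableEq κ]

/-- `I` is a set of leading variables of the system `∑ c_k x_k = 0`, `c ∈ N`. -/
def IsLeadingSet (N : Submodule F (κ → F)) (I : Set κ) : Prop :=
  ∀ y : κ → F, ∃! x : κ → F, (∀ c ∈ N, ∑ k, c k * x k = 0) ∧ ∀ k, k ∉ I → x k = y k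

variable {N : Submodule F (κ → F)} {I : Set κ}

/-- An equation in the free variables alone would forbid some choice of their values. This is
injectivity of the restriction of `N` to the coordinates in `I`. -/
theorem IsLeadingSet.eq_zero (h : IsLeadingSet N I) {c : κ → F} (hc : c ∈ N)
    (hI : ∀ k ∈ I, c k = 0) : c = 0 := by
  funext k
  by_contra hk
  obtain ⟨x, ⟨hx, hxy⟩, -⟩ := h (Pi.single k 1)
  have h1 := hx c hc
  rw [Finset.sum_eq_single k] at h1
  · have hkI : k ∉ I := fun hkI => hk (hI k hkI)
    rw [hxy k hkI, Pi.single_eq_same, mul_one] at h1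
    exact hk h1
  · intro j _ hj
    by_cases hjI : j ∈ I
    · rw [hI j hjI, zero_mul]
    · rw [hxy j hjI, Pi.single_eq_of_ne (M := fun _ => F) hj, mul_zero]
  · simp

/-- This is surjectivity of the restriction of `N` to the coordinates in `I`, and comes from
uniqueness of solutions. -/
theorem IsLeadingSet.exists_dual (h : IsLeadingSet N I) {i : κ} (hi : i ∈ I) :
    ∃ c ∈ N, c i = 1 ∧ ∀ j ∈ I, j ≠ i → c j = 0 := by
  classical
  let π : (κ → F) →ₗ[F] (κ → F) :=
    LinearMap.pi fun k => if k ∈ I then LinearMap.proj k else 0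
  have hπ : ∀ c k, π c k = if k ∈ I then c k else 0 := by
    intro c k
    simp only [π, LinearMap.pi_apply]
    split_ifs <;> rfl
  have key : (Pi.single i 1 : κ → F) ∈ N.map π := by
    by_contra hn
    obtain ⟨f, hf, hfN⟩ := Submodule.exists_le_ker_of_notMem hn
    -- The entries on `I` of a functional vanishing on `π(N)` solve the system with all free
    -- variables zero, just as the zero vector does; yet the entry at `i` is non-zero.
    set u : κ → F := fun k => if k ∈ I then f (Pi.single k 1) else 0 with hu
    obtain ⟨x, -, hx⟩ := h 0
    have h0 : (0 : κ → F) = x := hx 0 ⟨by simp, by simp⟩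
    have h1 : u = x := by
      refine hx u ⟨fun c hc => ?_, fun k hk => by simp [hu, hk]⟩
      have : f (π c) = 0 := hfN ⟨c, hc, rfl⟩
      rw [linearMap_apply_eq_sum] at this
      rw [← this]
      refine Finset.sum_congr rfl fun k _ => ?_
      rw [hπ, hu]
      by_cases hk : k ∈ I <;> simp [hk]
    have h2 : u i = 0 := by rw [h1, ← h0]; rfl
    rw [hu] at h2
    simp only [hi, if_true] at h2
    exact hf h2
  obtain ⟨c, hc, hci⟩ := key
  refine ⟨c, hc, ?_, fun j hj hji => ?_⟩
  · have := congrFun hci i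
    rwa [hπ, if_pos hi, Pi.single_eq_same] at this
  · have := congrFun hci j
    rwa [hπ, if_pos hj, Pi.single_eq_of_ne (M := fun _ => F) hji] at this

/-- Converse of `IsLeadingSet.eq_zero` and `IsLeadingSet.exists_dual`: the dual vectors span `N`, so
the system is in reduced echelon form and each leading variable is given explicitly by the free
ones. -/
theorem IsLeadingSet.of_dual (h0 : ∀ c ∈ N, (∀ k ∈ I, c k = 0) → c = 0)
    (h1 : ∀ i ∈ I, ∃ c ∈ N, c i = 1 ∧ ∀ j ∈ I, j ≠ i → c j = 0) : IsLeadingSet N I := by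
  classical
  choose! b hbN hb1 hb0 using h1
  have hrep : ∀ c ∈ N, c = ∑ i, (if i ∈ I then c i else 0) • b i := by
    intro c hc
    rw [← sub_eq_zero]
    refine h0 _ (Submodule.sub_mem _ hc (Submodule.sum_mem _ fun i _ => ?_)) fun k hk => ?_
    · split_ifs with hi
      · exact Submodule.smul_mem _ _ (hbN i hi)
      · simp
    · rw [Pi.sub_apply, Finset.sum_apply, Finset.sum_eq_single k]
      · simp [hk, hb1 k hk]
      · intro i _ hik
        by_cases hi : i ∈ I
        · simp [hb0 i hi k hk hik.symm]
        · simp [hi]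
      · simp
  intro y
  have hsol : ∀ x : κ → F, (∀ c ∈ N, ∑ k, c k * x k = 0) ↔ ∀ i ∈ I, ∑ k, b i k * x k = 0 := by
    refine fun x => ⟨fun h i hi => h _ (hbN i hi), fun h c hc => ?_⟩
    rw [hrep c hc]
    simp only [Finset.sum_apply, Pi.smul_apply, smul_eq_mul, Finset.sum_mul]
    rw [Finset.sum_comm]
    refine Finset.sum_eq_zero fun i _ => ?_
    by_cases hi : i ∈ I
    · simp only [mul_assoc, ← Finset.mul_sum, h i hi, mul_zero]
    · simp [hi]
  have hval : ∀ x : κ → F, ∀ i ∈ I, ∑ k, b i k * x k =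
      x i + ∑ k, if k ∈ I then 0 else b i k * x k := by
    intro x i hi
    have : x i = ∑ k, if k = i then x k else 0 := by simp
    rw [this, ← Finset.sum_add_distrib]
    refine Finset.sum_congr rfl fun k _ => ?_
    by_cases hk : k ∈ I
    · by_cases hki : k = i
      · subst hki
        simp [hk, hb1 k hk]
      · simp [hk, hki, hb0 i hi k hk hki]
    · have : k ≠ i := fun h => hk (h ▸ hi)
      simp [hk, this]
  refine ⟨fun k => if k ∈ I then -∑ j, (if j ∈ I then 0 else b k j * y j) else y k,
    ⟨(hsol _).mpr fun i hi => ?_, fun k hk => by simp [hk]⟩, ?_⟩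
  · rw [hval _ i hi]
    simp only [hi, if_true]
    rw [neg_add_eq_zero]
    refine Finset.sum_congr rfl fun j _ => ?_
    by_cases hj : j ∈ I <;> simp [hj]
  · rintro x ⟨hx, hxy⟩
    funext k
    by_cases hk : k ∈ I
    · have := (hsol x).mp hx k hk
      rw [hval x k hk] at this
      simp only [hk, if_true]
      rw [eq_neg_of_add_eq_zero_left this]
      congr 1
      refine Finset.sum_congr rfl fun j _ => ?_
      by_cases hj : j ∈ I
      · simp [hj]
      · simp [hj, hxy j hj]
    · simp [hk, hxy k hk]

/-- Basis exchange: `c` is a multiple of the dual vector of `i`, and a non-zero entry at `j` makes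
it a pivot there, so `j` can take the place of `i`. -/
theorem IsLeadingSet.exchange (h : IsLeadingSet N I) {i j : κ} (hi : i ∈ I) (hj : j ∉ I)
    {c : κ → F} (hc : c ∈ N) (hcI : ∀ k ∈ I, k ≠ i → c k = 0) (hcj : c j ≠ 0)
    {J : Set κ} (hJ : ∀ k, k ∈ J ↔ k = j ∨ k ∈ I ∧ k ≠ i) : IsLeadingSet N J := by
  refine IsLeadingSet.of_dual (fun x hx hxJ => ?_) fun k hk => ?_
  · have h1 : x = 0 ∨ x i ≠ 0 := by
      by_cases hxi : x i = 0
      · refine Or.inl (h.eq_zero hx fun k hk => ?_)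
        by_cases hki : k = i
        · rw [hki, hxi]
        · exact hxJ k ((hJ k).mpr (Or.inr ⟨hk, hki⟩))
      · exact Or.inr hxi
    refine h1.resolve_right fun hxi => ?_
    have h2 : c i • x - x i • c = 0 := by
      refine h.eq_zero (N.sub_mem (N.smul_mem _ hx) (N.smul_mem _ hc)) fun k hk => ?_
      by_cases hki : k = i
      · subst hki
        simp [mul_comm]
      · simp [hcI k hk hki, hxJ k ((hJ k).mpr (Or.inr ⟨hk, hki⟩))]
    have h3 := congrFun h2 j
    simp [hxJ j ((hJ j).mpr (Or.inl rfl)), hxi, hcj] at h3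
  · by_cases hkj : k = j
    · subst hkj
      refine ⟨(c k)⁻¹ • c, N.smul_mem _ hc, by simp [hcj], fun l hl hlk => ?_⟩
      have := ((hJ l).mp hl).resolve_left hlk
      simp [hcI l this.1 this.2]
    · have hkI := ((hJ k).mp hk).resolve_left hkj
      obtain ⟨b, hb, hb1, hb0⟩ := h.exists_dual hkI.1
      refine ⟨b - (b j / c j) • c, N.sub_mem hb (N.smul_mem _ hc), ?_, fun l hl hlk => ?_⟩
      · simp [hb1, hcI k hkI.1 hkI.2]
      · rcases (hJ l).mp hl with rfl | hl'
        · simp [hcj]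
        · simp [hb0 l hl'.1 hlk, hcI l hl'.1 hl'.2]

/-- A basis which is unitriangular with respect to the death times `δ`, given by its coordinate map,
and adapted both to the filtration by the weights `w` and to the filtration `B`. -/
theorem exists_adapted_coordinates {ι : Type*} [Fintype ι] [DecidableEq ι] (w : ι → ℝ)
    (δ : ι → EReal) (B : ℝ → Submodule F (ι → F))
    (hb : ∀ K, ∃ b : ι → F, (∀ t : ℝ, δ K ≤ t → b ∈ B t) ∧ b K = 1 ∧
      ∀ L, L ≠ K → b L ≠ 0 → δ K < δ L ∧ w L ≤ w K)
    (hB : ∀ t : ℝ, ∀ f ∈ B t, (∀ K, f K ≠ 0 → (t : EReal) < δ K) → f = 0) :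
    ∃ Θ : (ι → F) ≃ₗ[F] (ι → F),
      (∀ t f, (∀ K, Θ f K ≠ 0 → w K ≤ t) ↔ ∀ K, f K ≠ 0 → w K ≤ t) ∧
      (∀ (t : ℝ) f, (∀ K, Θ f K ≠ 0 → δ K ≤ (t : EReal)) ↔ f ∈ B t) ∧
      (∀ (t : ℝ) f, (∀ K, Θ f K ≠ 0 → (t : EReal) < δ K) ↔ ∀ K, f K ≠ 0 → (t : EReal) < δ K) ∧
      ∀ K, Θ (Pi.single K 1) K = 1 := by
  classical
  choose b hbB hb1 hb0 using hb
  let β : (ι → F) →ₗ[F] (ι → F) := Fintype.linearCombination F b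
  have hβ : ∀ f K, β f K = ∑ L, f L * b L K := by
    intro f K
    simp [β, Fintype.linearCombination_apply, Finset.sum_apply]
  -- If `S` is closed under passing to later deaths and no larger weights, unitriangularity makes
  -- `β` preserve and reflect support in `S`: outside `S`, an entry of earliest death receives no
  -- other contribution and cannot cancel. All the claims below are instances for suitable `S`; `S =
  -- ∅` gives injectivity.
  have hβS : ∀ S : Set ι, (∀ L ∈ S, ∀ K, δ L < δ K → w K ≤ w L → K ∈ S) → ∀ f,
      (∀ K, β f K ≠ 0 → K ∈ S) ↔ ∀ K, f K ≠ 0 → K ∈ S := by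
    refine fun S hS f => ⟨fun h => ?_, fun h K hK => ?_⟩
    · by_contra! hcon
      obtain ⟨K, hK, hmin⟩ := Finset.exists_min_image
        (Finset.univ.filter fun K => f K ≠ 0 ∧ K ∉ S) δ
        ⟨hcon.choose, by simpa using hcon.choose_spec⟩
      simp only [Finset.mem_filter, Finset.mem_univ, true_and] at hK hmin
      refine hK.2 (h K ?_)
      rw [hβ, Finset.sum_eq_single K, hb1, mul_one]
      · exact hK.1
      · intro L _ hLK
        by_contra hne
        have hne' := mul_ne_zero_iff.mp hne
        have h1 := hb0 L K hLK.symm hne'.2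
        exact absurd (hmin L ⟨hne'.1, fun hL => hK.2 (hS L hL K h1.1 h1.2)⟩) (not_le.mpr h1.1)
      · simp
    · rw [hβ] at hK
      obtain ⟨L, -, hL⟩ := Finset.exists_ne_zero_of_sum_ne_zero hK
      have hL' := mul_ne_zero_iff.mp hL
      by_cases hKL : K = L
      · exact h K (hKL ▸ hL'.1)
      · have h1 := hb0 L K hKL hL'.2
        exact hS L (h L hL'.1) K h1.1 h1.2
  have hinj : Function.Injective β := by
    rw [injective_iff_map_eq_zero]
    intro f hf
    have := (hβS ∅ (by simp) f).mp (by simp [hf])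
    funext K
    by_contra hK
    exact this K hK
  let Θ := (LinearEquiv.ofInjectiveEndo β hinj).symm
  have hΘ : ∀ f, β (Θ f) = f := fun f =>
    (LinearEquiv.ofInjectiveEndo β hinj).apply_symm_apply f
  have hΘS : ∀ S : Set ι, (∀ L ∈ S, ∀ K, δ L < δ K → w K ≤ w L → K ∈ S) → ∀ f,
      (∀ K, Θ f K ≠ 0 → K ∈ S) ↔ ∀ K, f K ≠ 0 → K ∈ S := by
    intro S hS f
    rw [← hβS S hS (Θ f), hΘ]
  refine ⟨Θ, fun t => hΘS {K | w K ≤ t} fun L hL K _ h => h.trans hL, fun t f => ?_,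
    fun t => hΘS {K | (t : EReal) < δ K} fun L hL K h _ => lt_trans hL h, fun K => ?_⟩
  · have hBβ : ∀ g : ι → F, (∀ K, g K ≠ 0 → δ K ≤ (t : EReal)) → β g ∈ B t :=
      fun g hg => map_mem_of_forall_single β _ fun K hK => by
        simpa [β, Fintype.linearCombination_apply_single] using hbB K t (hg K hK)
    constructor
    · intro h
      rw [← hΘ f]
      exact hBβ _ h
    · intro hf
      -- The part of `f` along the basis vectors dead by `t` lies in `B t`. The remainder then lies
      -- in `B t` too and is supported on later deaths, so it vanishes by `hB`.
      set g₁ : ι → F := fun K => if δ K ≤ (t : EReal) then Θ f K else 0 with hg₁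
      have h1 : β g₁ ∈ B t := hBβ _ fun K hK => by
        by_contra h
        simp [hg₁, h] at hK
      have h2 : β (Θ f - g₁) = 0 := by
        refine hB t _ ?_ ((hβS {K | (t : EReal) < δ K}
          (fun L hL K h _ => lt_trans hL h) _).mpr fun K hK => ?_)
        · rw [map_sub, hΘ]
          exact Submodule.sub_mem _ hf h1
        · by_contra h
          have : δ K ≤ (t : EReal) := not_lt.mp h
          simp [hg₁, this] at hK
      have h3 : Θ f = g₁ := sub_eq_zero.mp (hinj (h2.trans (map_zero β).symm))
      intro K hK
      rw [h3] at hK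
      by_contra h
      simp [hg₁, h] at hK
  · set g := Θ (Pi.single K 1) with hg
    -- Apart from `b K` itself, only basis vectors of later death occur in the expansion of the unit
    -- vector at `K`, and those vanish at `K`.
    have h1 : ∀ L, g L ≠ 0 → L = K ∨ δ K < δ L ∧ w L ≤ w K := by
      refine (hΘS {L | L = K ∨ δ K < δ L ∧ w L ≤ w K} ?_ (Pi.single K 1)).mpr ?_
      · rintro L (rfl | hL) M hM hw
        · exact Or.inr ⟨hM, hw⟩
        · exact Or.inr ⟨hL.1.trans hM, hw.trans hL.2⟩
      · intro L hL
        left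
        by_contra h
        exact hL (Pi.single_eq_of_ne (M := fun _ => F) h 1)
    have h2 : β g K = 1 := by rw [hg, hΘ, Pi.single_eq_same]
    rw [hβ, Finset.sum_eq_single K, hb1, mul_one] at h2
    · exact h2
    · intro L _ hLK
      by_contra hne
      have hne' := mul_ne_zero_iff.mp hne
      have h3 := (h1 L hne'.1).resolve_left hLK
      exact absurd (hb0 L K hLK.symm hne'.2).1 (not_lt.mpr h3.1.le)
    · simp

end LinearSystems

/-! ### Spanning trees, and cycles as functions on the critical faces -/

section Trees

variable {F : Type*} [Field F] {P : Type*} [Fintype P] [LinearOrder P]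

theorem mem_fullSimplex {A : Finset P} : A ∈ fullSimplex P ↔ A.Nonempty := by
  simp [fullSimplex]

theorem mem_critical {d : ℕ} {T : Finset (Finset P)} {K : Finset P} :
    K ∈ critical d T ↔ K.card = d + 1 ∧ K ∉ T := by
  simp only [critical, facesOff, Finset.mem_filter, mem_fullSimplex, and_iff_right_iff_imp]
  exact fun h => Finset.card_pos.mp (by omega)

theorem isComplex_fullSimplex : IsComplex (fullSimplex P) :=
  fun _ hA => ⟨mem_fullSimplex.mp hA, fun _ _ hB => mem_fullSimplex.mpr hB⟩

theorem IsTree.eq_zero {d : ℕ} {T : Finset (Finset P)} (hT : IsTree F d T) {z : Finset P → F}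
    (hz : z ∈ chains F d T) (h0 : boundary F z = 0) : z = 0 :=
  (subsingleton_homology_iff hT.1.2.1).mp hT.1.2.2 z hz h0

/-- The boundary of `c` is a cycle of `T` because `T` is spanning, and it goes to zero in the
homology of the point; injectivity of that map makes it a boundary in `T`. Working in degree `d - 1`
over the integers covers `d = 0`. -/
theorem IsTree.exists_boundary_eq {d : ℕ} {T : Finset (Finset P)} (hT : IsTree F d T)
    (hs : IsSpanning d T (fullSimplex P)) {c : Finset P → F}
    (hc : c ∈ chains F d (fullSimplex P)) : ∃ τ ∈ chains F d T, boundary F τ = boundary F c := by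
  have h1 : boundary F c ∈ chains F ((d : ℤ) - 1) T := by
    intro A hA
    have := boundary_mem_chains isComplex_fullSimplex hc A hA
    exact ⟨(hs A (by omega)).mpr this.1, this.2⟩
  have h2 := (toPoint_bijective_iff.mp hT.2).1 (boundary F c)
    (mem_relCycles_empty.mpr ⟨h1, boundary_boundary c⟩)
    (by rw [collapse_boundary]; exact Submodule.zero_mem _)
  rw [mem_relBoundaries_empty, sub_add_cancel] at h2
  exact h2

/-- The faces below dimension `d` do not change, and the relation `∂e = ∂τ` with `τ t ≠ 0` expresses
the boundaries of `e` and `t` through each other. So cycles and boundaries in degree `d - 1` are the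
same for both complexes. -/
theorem isTree_exchange {d : ℕ} {T : Finset (Finset P)} (hT : IsTree F d T)
    (hs : IsSpanning d T (fullSimplex P)) {e t : Finset P} (he : e.card = d + 1) (heT : e ∉ T)
    (htT : t ∈ T) (ht : t.card = d + 1) {τ : Finset P → F} (hτ : τ ∈ chains F d T)
    (hb : boundary F τ = boundary F (Pi.single e 1)) (hτt : τ t ≠ 0) :
    IsTree F d (insert e (T.erase t)) ∧ IsSpanning d (insert e (T.erase t)) (fullSimplex P) := by
  have hte : t ≠ e := fun h => heT (h ▸ htT)
  have hmem : ∀ A : Finset P, A.card ≤ d → (A ∈ insert e (T.erase t) ↔ A ∈ T) := by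
    intro A hA
    have h1 : A ≠ e := fun h => by rw [h] at hA; omega
    have h2 : A ≠ t := fun h => by rw [h] at hA; omega
    simp [h1, h2]
  have hspan : IsSpanning d (insert e (T.erase t)) (fullSimplex P) :=
    fun A hA => (hmem A hA).trans (hs A hA)
  have hdim : DimLE d (insert e (T.erase t)) := by
    intro A hA
    rcases Finset.mem_insert.mp hA with rfl | hA
    · exact he.le
    · exact hT.1.2.1 A (Finset.mem_of_mem_erase hA)
  have hcomplex : IsComplex (insert e (T.erase t)) := by
    intro A hA
    rcases Finset.mem_insert.mp hA with rfl | hA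
    · refine ⟨Finset.card_pos.mp (by omega), fun B hB hBne => ?_⟩
      rcases eq_or_ne B A with rfl | hne
      · exact Finset.mem_insert_self _ _
      · have := Finset.card_lt_card (Finset.ssubset_iff_subset_ne.mpr ⟨hB, hne⟩)
        exact (hspan B (by omega)).mpr (mem_fullSimplex.mpr hBne)
    · have hA' := Finset.mem_erase.mp hA
      refine ⟨(hT.1.1 hA'.2).1, fun B hB hBne => Finset.mem_insert_of_mem
        (Finset.mem_erase.mpr ⟨?_, (hT.1.1 hA'.2).2 hB hBne⟩)⟩
      rintro rfl
      exact hA'.1 (Finset.eq_of_subset_of_card_le hB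
        (ht ▸ hT.1.2.1 A hA'.2)).symm
  have hsub : ∀ A ∈ T, A ≠ t → A ∈ insert e (T.erase t) := fun A hA h =>
    Finset.mem_insert_of_mem (Finset.mem_erase.mpr ⟨h, hA⟩)
  have hchains : chains F ((d : ℤ) - 1) (insert e (T.erase t)) = chains F ((d : ℤ) - 1) T := by
    ext c
    refine forall_congr' fun A => imp_congr_right fun _ => and_congr_left fun h => ?_
    exact hmem A (by omega)
  have hcyc : relCycles F ((d : ℤ) - 1) (insert e (T.erase t)) ∅ =
      relCycles F ((d : ℤ) - 1) T ∅ := by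
    simp only [relCycles, hchains]
  have hbd : relBoundaries F ((d : ℤ) - 1) (insert e (T.erase t)) ∅ =
      relBoundaries F ((d : ℤ) - 1) T ∅ := by
    simp only [relBoundaries, sub_add_cancel]
    congr 1
    apply le_antisymm
    · rintro _ ⟨c, hc, rfl⟩
      refine map_mem_of_forall_single (boundary F) _ fun A hA => ?_
      have hA' := hc A hA
      rcases Finset.mem_insert.mp hA'.1 with rfl | hAT
      · exact ⟨τ, hτ, hb⟩
      · exact ⟨_, single_mem_chains (Finset.mem_of_mem_erase hAT) hA'.2 1, rfl⟩
    · rintro _ ⟨c, hc, rfl⟩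
      refine map_mem_of_forall_single (boundary F) _ fun A hA => ?_
      have hA' := hc A hA
      by_cases hAt : A = t
      · subst hAt
        refine ⟨(τ A)⁻¹ • (Pi.single e 1 - (τ - τ A • Pi.single A 1)), ?_, ?_⟩
        · refine Submodule.smul_mem _ _ (Submodule.sub_mem _ (single_mem_chains
            (Finset.mem_insert_self _ _) (by simp [he]) 1) fun B hB => ?_)
          by_cases hBA : B = A
          · subst hBA
            simp at hB
          · have hB' : τ B ≠ 0 := by simpa [hBA] using hB
            exact ⟨hsub B (hτ B hB').1 hBA, (hτ B hB').2⟩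
        · simp only [map_smul, map_sub, hb, sub_sub_cancel]
          rw [smul_smul, inv_mul_cancel₀ hτt, one_smul]
      · exact ⟨_, single_mem_chains (hsub A hA'.1 hAt) hA'.2 1, rfl⟩
  refine ⟨⟨⟨hcomplex, hdim, (subsingleton_homology_iff hdim).mpr fun z hz hz0 => ?_⟩, ?_⟩, hspan⟩
  · have hzt : z t = 0 := apply_eq_zero_of_mem_chains hz (by simp [hte])
    -- Replacing `e` by `τ` turns `z` into a cycle of `T`, which is zero. Its entry at `t`, where
    -- `z` vanishes, is `z e * τ t`; this gives `z e = 0`.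
    have h1 : z - z e • (Pi.single e 1 - τ) = 0 := by
      refine hT.eq_zero (fun A hA => ?_) (by simp [hz0, hb])
      by_cases hτA : τ A = 0
      · have hAe : A ≠ e := by
          rintro rfl
          simp [hτA] at hA
        have hzA : z A ≠ 0 := by simpa [hτA, hAe] using hA
        have := hz A hzA
        exact ⟨Finset.mem_of_mem_erase ((Finset.mem_insert.mp this.1).resolve_left hAe), this.2⟩
      · exact hτ A hτA
    have h2 := congrFun h1 t
    simp only [Pi.sub_apply, Pi.smul_apply, Pi.single_eq_of_ne (M := fun _ => F) hte, hzt,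
      zero_sub, smul_eq_mul, mul_neg, neg_neg, Pi.zero_apply, mul_eq_zero, hτt, or_false] at h2
    simpa [h2] using h1
  · rw [toPoint_bijective_iff, hcyc, hbd]
    exact toPoint_bijective_iff.mp hT.2

/-- Any face of the tree chain can be exchanged for `e`, so by minimality of the tree none is
heavier than `e`. This links the tree to all stages of the filtration at once. -/
theorem IsMinSpanningTree.exists_boundary_eq_single {w : Weighting P} {d : ℕ}
    {T : Finset (Finset P)} (hT : IsMinSpanningTree F w d T) (e : Finset P)
    (he : e.card = d + 1) :
    ∃ τ ∈ chains F d T, boundary F τ = boundary F (Pi.single e 1) ∧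
      ∀ t, τ t ≠ 0 → w.weight t ≤ w.weight e := by
  by_cases heT : e ∈ T
  · refine ⟨Pi.single e 1, single_mem_chains heT (by simp [he]) 1, rfl, fun t ht => ?_⟩
    by_cases hte : t = e
    · rw [hte]
    · exact absurd (Pi.single_eq_of_ne (M := fun _ => F) hte 1) ht
  · obtain ⟨τ, hτ, hb⟩ := hT.1.1.exists_boundary_eq hT.1.2 (c := Pi.single e 1)
      (single_mem_chains (mem_fullSimplex.mpr (Finset.card_pos.mp (by omega))) (by simp [he]) 1)
    refine ⟨τ, hτ, hb, fun t ht => ?_⟩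
    have htT := hτ t ht
    obtain ⟨h1, h2⟩ := isTree_exchange hT.1.1 hT.1.2 he heT htT.1
      (by have := htT.2; omega) hτ hb ht
    have h3 := hT.2 _ h1 h2
    have h4 : e ∉ T.erase t := fun h => heT (Finset.mem_of_mem_erase h)
    simp only [Weighting.total] at h3
    rw [Finset.sum_insert h4, ← Finset.add_sum_erase _ _ htT.1] at h3
    linarith

theorem mem_stage {w : Weighting P} {a : ℝ} {A : Finset P} :
    A ∈ w.stage a ↔ A.Nonempty ∧ w.weight A ≤ a := by
  simp [Weighting.stage, Weighting.reduced, mem_fullSimplex]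

theorem mem_reduced {w : Weighting P} {S : Finset (Finset P)} {a : ℝ} {A : Finset P} :
    A ∈ w.reduced S a ↔ A ∈ S ∧ w.weight A ≤ a := by
  simp [Weighting.reduced]

theorem isComplex_stage (w : Weighting P) (a : ℝ) : IsComplex (w.stage a) := by
  intro A hA
  have := mem_stage.mp hA
  exact ⟨this.1, fun B hB hBne => mem_stage.mpr ⟨hBne, (w.mono B A hBne hB).trans this.2⟩⟩

theorem stage_subset_fullSimplex (w : Weighting P) (a : ℝ) : w.stage a ⊆ fullSimplex P :=
  Finset.filter_subset _ _

theorem stage_mono (w : Weighting P) {a b : ℝ} (h : a ≤ b) : w.stage a ⊆ w.stage b := by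
  intro A hA
  have := mem_stage.mp hA
  exact mem_stage.mpr ⟨this.1, this.2.trans h⟩

/-- The critical `d`-faces, as a type. -/
abbrev Crit (d : ℕ) (T : Finset (Finset P)) : Type _ := {K : Finset P // K ∈ critical d T}

variable (F) in
/-- The coefficients of a chain at the critical faces. -/
def critCoeffs (d : ℕ) (T : Finset (Finset P)) : (Finset P → F) →ₗ[F] (Crit d T → F) :=
  LinearMap.funLeft F F Subtype.val

@[simp]
theorem critCoeffs_apply {d : ℕ} {T : Finset (Finset P)} (z : Finset P → F) (K : Crit d T) :
    critCoeffs F d T z K = z K.1 := rfl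

theorem mem_chains_tree_of_critCoeffs_eq_zero {d : ℕ} {w : Weighting P} {a : ℝ}
    {T : Finset (Finset P)} {z : Finset P → F} (hz : z ∈ chains F d (w.stage a))
    (h : critCoeffs F d T z = 0) : z ∈ chains F d (w.reduced T a) := by
  intro A hA
  have h1 := hz A hA
  refine ⟨mem_reduced.mpr ⟨?_, (mem_stage.mp h1.1).2⟩, h1.2⟩
  by_contra hAT
  exact hA (congrFun h ⟨A, mem_critical.mpr ⟨by have := h1.2; omega, hAT⟩⟩)

variable {w : Weighting P} {d : ℕ} {T : Finset (Finset P)}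

/-- The unique chain of the tree with the same boundary as the face `e`. -/
noncomputable def treeChain (hT : IsMinSpanningTree F w d T) (K : Crit d T) : Finset P → F :=
  (hT.exists_boundary_eq_single K.1 (mem_critical.mp K.2).1).choose

theorem treeChain_spec (hT : IsMinSpanningTree F w d T) (K : Crit d T) :
    treeChain hT K ∈ chains F d T ∧
      boundary F (treeChain hT K) = boundary F (Pi.single K.1 1) ∧
      ∀ t, treeChain hT K t ≠ 0 → w.weight t ≤ w.weight K.1 :=
  (hT.exists_boundary_eq_single K.1 (mem_critical.mp K.2).1).choose_spec

/-- The `d`-cycle with prescribed coefficients at the critical faces. -/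
noncomputable def critCycle (hT : IsMinSpanningTree F w d T) : (Crit d T → F) →ₗ[F] (Finset P → F) :=
  Fintype.linearCombination F fun K => Pi.single K.1 1 - treeChain hT K

theorem critCycle_single (hT : IsMinSpanningTree F w d T) (K : Crit d T) :
    critCycle hT (Pi.single K 1) = Pi.single K.1 1 - treeChain hT K := by
  simp [critCycle, Fintype.linearCombination_apply_single]

theorem boundary_critCycle (hT : IsMinSpanningTree F w d T) (f : Crit d T → F) :
    boundary F (critCycle hT f) = 0 := by
  rw [← Submodule.mem_bot F, ← LinearMap.comp_apply]
  refine map_mem_of_forall_single _ _ fun K _ => ?_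
  rw [LinearMap.comp_apply, critCycle_single, map_sub, (treeChain_spec hT K).2.1, sub_self]
  exact Submodule.zero_mem _

theorem critCoeffs_critCycle (hT : IsMinSpanningTree F w d T) (f : Crit d T → F) :
    critCoeffs F d T (critCycle hT f) = f := by
  have : critCoeffs F d T ∘ₗ critCycle hT = LinearMap.id := by
    refine LinearMap.pi_ext' fun K => LinearMap.ext_ring ?_
    simp only [LinearMap.comp_apply, LinearMap.single_apply, critCycle_single, LinearMap.id_apply]
    funext L
    rw [critCoeffs_apply, Pi.sub_apply, apply_eq_zero_of_mem_chains (treeChain_spec hT K).1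
      (mem_critical.mp L.2).2, sub_zero]
    by_cases h : L = K
    · subst h
      simp
    · rw [Pi.single_eq_of_ne (M := fun _ => F) h,
        Pi.single_eq_of_ne (M := fun _ => F) fun h' => h (Subtype.ext h')]
  exact LinearMap.congr_fun this f

theorem critCycle_mem_chains (hT : IsMinSpanningTree F w d T) {C : Finset (Finset P)} {a : ℝ}
    (hC : w.reduced T a ⊆ C) {f : Crit d T → F}
    (hf : ∀ K, f K ≠ 0 → K.1 ∈ C ∧ w.weight K.1 ≤ a) : critCycle hT f ∈ chains F d C := by
  refine map_mem_of_forall_single _ _ fun K hK => ?_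
  rw [critCycle_single]
  refine Submodule.sub_mem _ (single_mem_chains (hf K hK).1 ?_ 1) fun A hA => ?_
  · have := (mem_critical.mp K.2).1
    omega
  · have := treeChain_spec hT K
    exact ⟨hC (mem_reduced.mpr ⟨(this.1 A hA).1, (this.2.2 A hA).trans (hf K hK).2⟩),
      (this.1 A hA).2⟩

theorem reduced_subset_stage (hT : IsMinSpanningTree F w d T) (a : ℝ) :
    w.reduced T a ⊆ w.stage a := by
  intro A hA
  have := mem_reduced.mp hA
  exact mem_stage.mpr ⟨(hT.1.1.1.1 this.1).1, this.2⟩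

theorem critCycle_mem_chains_stage (hT : IsMinSpanningTree F w d T) {a : ℝ} {f : Crit d T → F}
    (hf : ∀ K, f K ≠ 0 → w.weight K.1 ≤ a) : critCycle hT f ∈ chains F d (w.stage a) :=
  critCycle_mem_chains hT (reduced_subset_stage hT a) fun K hK =>
    ⟨mem_stage.mpr ⟨Finset.card_pos.mp (by have := (mem_critical.mp K.2).1; omega), hf K hK⟩,
      hf K hK⟩

/-- The difference is a `d`-cycle supported on `T`, hence zero. -/
theorem eq_of_critCoeffs_eq (hT : IsMinSpanningTree F w d T) {y z : Finset P → F}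
    (hy : y ∈ chains F d (fullSimplex P)) (hz : z ∈ chains F d (fullSimplex P))
    (hyz : boundary F y = boundary F z) (h : critCoeffs F d T y = critCoeffs F d T z) :
    y = z := by
  rw [← sub_eq_zero]
  refine hT.1.1.eq_zero (fun A hA => ?_) (by rw [map_sub, hyz, sub_self])
  have h1 := Submodule.sub_mem _ hy hz A hA
  refine ⟨?_, h1.2⟩
  by_contra hAT
  refine hA (sub_eq_zero.mpr ?_)
  exact congrFun h ⟨A, mem_critical.mpr ⟨by have := h1.2; omega, hAT⟩⟩

theorem critCycle_mem_chains_fullSimplex (hT : IsMinSpanningTree F w d T) (f : Crit d T → F) :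
    critCycle hT f ∈ chains F d (fullSimplex P) := by
  obtain ⟨M, hM⟩ := (Finset.univ.image fun K : Crit d T => w.weight K.1).exists_le
  exact chains_mono (stage_subset_fullSimplex w M) (critCycle_mem_chains_stage hT fun K _ =>
    hM _ (Finset.mem_image_of_mem _ (Finset.mem_univ K)))

theorem critCycle_critCoeffs (hT : IsMinSpanningTree F w d T) {z : Finset P → F}
    (hz : z ∈ chains F d (fullSimplex P)) (hz0 : boundary F z = 0) :
    critCycle hT (critCoeffs F d T z) = z :=
  eq_of_critCoeffs_eq hT (critCycle_mem_chains_fullSimplex hT _) hz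
    (by rw [boundary_critCycle, hz0]) (critCoeffs_critCycle hT _)

variable (F w d T) in
/-- The critical coefficients of the `d`-boundaries of the stage at `a`. -/
noncomputable def critBoundaries (a : ℝ) : Submodule F (Crit d T → F) :=
  ((chains F (d + 1) (w.stage a)).map (boundary F)).map (critCoeffs F d T)

theorem boundary_mem_chains_stage {a : ℝ} {c : Finset P → F}
    (hc : c ∈ chains F (d + 1) (w.stage a)) : boundary F c ∈ chains F d (w.stage a) := by
  have := boundary_mem_chains (isComplex_stage w a) hc
  rwa [add_sub_cancel_right] at this

theorem critCoeffs_mem_critBoundaries_iff (hT : IsMinSpanningTree F w d T) {a : ℝ}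
    {z : Finset P → F} (hz : z ∈ chains F d (fullSimplex P)) (hz0 : boundary F z = 0) :
    critCoeffs F d T z ∈ critBoundaries F w d T a ↔
      ∃ c ∈ chains F (d + 1) (w.stage a), boundary F c = z := by
  constructor
  · rintro ⟨_, ⟨c, hc, rfl⟩, h⟩
    exact ⟨c, hc, eq_of_critCoeffs_eq hT (chains_mono (stage_subset_fullSimplex w a)
      (boundary_mem_chains_stage hc)) hz (by rw [boundary_boundary, hz0]) h⟩
  · rintro ⟨c, hc, rfl⟩
    exact ⟨_, ⟨c, hc, rfl⟩, rfl⟩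

theorem weight_le_of_mem_critBoundaries {a : ℝ} {f : Crit d T → F}
    (hf : f ∈ critBoundaries F w d T a) {K : Crit d T} (hK : f K ≠ 0) : w.weight K.1 ≤ a := by
  obtain ⟨_, ⟨c, hc, rfl⟩, rfl⟩ := hf
  exact (mem_stage.mp (boundary_mem_chains_stage hc K.1 hK).1).2

theorem critBoundaries_mono {a b : ℝ} (h : a ≤ b) :
    critBoundaries F w d T a ≤ critBoundaries F w d T b :=
  Submodule.map_mono (Submodule.map_mono (chains_mono (stage_mono w h)))

end Trees

/-! ### Death times and the killing boundaries they provide -/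

section Deaths

variable {F : Type*} [Field F] {P : Type*} [Fintype P] [LinearOrder P]
variable {w : Weighting P} {d : ℕ} {T : Finset (Finset P)}

variable (F d T) in
/-- Extension by zero of a function on a set `S` of faces to all critical faces. -/
noncomputable def extendCrit (S : Finset (Finset P)) :
    ({K // K ∈ S} → F) →ₗ[F] (Crit d T → F) :=
  critCoeffs F d T ∘ₗ Fintype.linearCombination F fun K => Pi.single K.1 1

theorem extendCrit_apply (S : Finset (Finset P)) (c : {K // K ∈ S} → F) (K : Crit d T) :
    extendCrit F d T S c K = if h : K.1 ∈ S then c ⟨K.1, h⟩ else 0 := by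
  simp only [extendCrit, LinearMap.comp_apply, critCoeffs_apply,
    Fintype.linearCombination_apply, Finset.sum_apply, Pi.smul_apply, smul_eq_mul]
  split_ifs with h
  · rw [Finset.sum_eq_single ⟨K.1, h⟩]
    · simp
    · intro L _ hL
      have : K.1 ≠ L.1 := fun h' => hL (Subtype.ext h'.symm)
      simp [this]
    · simp
  · refine Finset.sum_eq_zero fun L _ => ?_
    have : K.1 ≠ L.1 := fun h' => h (h' ▸ L.2)
    simp [this]

theorem single_mem_relCycles (hT : IsMinSpanningTree F w d T) {a : ℝ} {C : Finset (Finset P)}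
    {K : Finset P} (hKC : K ∈ C) (hK : K.card = d + 1) (hw : w.weight K ≤ a) :
    Pi.single K 1 ∈ relCycles F d C (w.reduced T a) := by
  refine ⟨single_mem_chains hKC (by simp [hK]) 1, ?_⟩
  have h := boundary_mem_chains (isComplex_stage w a)
    (single_mem_chains (F := F) (k := d) (X := w.stage a) (A := K)
      (mem_stage.mpr ⟨Finset.card_pos.mp (by omega), hw⟩) (by simp [hK]) 1)
  intro A hA
  have h1 := h A hA
  have h2 := mem_stage.mp h1.1
  exact ⟨mem_reduced.mpr
    ⟨(hT.1.2 A (by omega)).mpr (mem_fullSimplex.mpr h2.1), h2.2⟩, h1.2⟩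

/-- A combination of the `[K]` dies relative to the tree exactly when it differs from a boundary by
a chain of the tree, that is, when the two agree at all critical faces. This puts the system into
the form of `IsLeadingSet`. -/
theorem solves_iff (hT : IsMinSpanningTree F w d T) {a : ℝ} {S : Finset (Finset P)}
    (hS : ∀ K ∈ S, K ∈ critical d T ∧ w.weight K ≤ a) (x : {K // K ∈ S} → F) :
    Solves F w d T a S x ↔
      ∀ c ∈ (critBoundaries F w d T a).comap (extendCrit F d T S), ∑ K, c K * x K = 0 := by
  refine forall_congr' fun c => imp_congr_left ?_
  have hsub : w.reduced T a ∪ S ⊆ w.stage a := by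
    refine Finset.union_subset (reduced_subset_stage hT a) fun K hK => mem_stage.mpr
      ⟨Finset.card_pos.mp ?_, (hS K hK).2⟩
    have := (mem_critical.mp (hS K hK).1).1
    omega
  have hcyc : ∀ K : {K // K ∈ S}, (Pi.single K.1 1 : Finset P → F) ∈
      relCycles F d (w.reduced T a ∪ S) (w.reduced T a) := fun K =>
    single_mem_relCycles hT (Finset.mem_union_right _ K.2)
      (mem_critical.mp (hS K.1 K.2).1).1 (hS K.1 K.2).2
  have hsum : ∑ K, c K • (Pi.single K.1 1 : Finset P → F) ∈
      relCycles F d (w.reduced T a ∪ S) (w.reduced T a) :=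
    Submodule.sum_mem _ fun K _ => Submodule.smul_mem _ _ (hcyc K)
  have hsum' := relCycles_mono hsub subset_rfl hsum
  rw [LinearMap.mem_ker, sum_smul_relClass _ _ hcyc, relMap_relClass hsub subset_rfl hsum,
    relClass_eq_zero_iff hsum', mem_relBoundaries, Submodule.mem_comap, extendCrit,
    LinearMap.comp_apply, Fintype.linearCombination_apply]
  constructor
  · rintro ⟨b, hb, hz⟩
    refine ⟨_, ⟨b, hb, rfl⟩, ?_⟩
    rw [eq_comm, ← sub_eq_zero, ← map_sub]
    funext K
    exact apply_eq_zero_of_mem_chains hz fun h =>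
      (mem_critical.mp K.2).2 (mem_reduced.mp h).1
  · rintro ⟨_, ⟨b, hb, rfl⟩, h⟩
    refine ⟨b, hb, mem_chains_tree_of_critCoeffs_eq_zero
      (Submodule.sub_mem _ hsum'.1 (boundary_mem_chains_stage hb)) ?_⟩
    rw [map_sub, h, sub_self]

theorem isLeading_iff (hT : IsMinSpanningTree F w d T) {a : ℝ} {S I : Finset (Finset P)}
    (hS : ∀ K ∈ S, K ∈ critical d T ∧ w.weight K ≤ a) :
    IsLeading F w d T a S I ↔ I ⊆ S ∧
      IsLeadingSet ((critBoundaries F w d T a).comap (extendCrit F d T S)) {K | K.1 ∈ I} := by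
  simp only [IsLeading, IsLeadingSet, solves_iff hT hS, Set.mem_ofPred_eq]

variable {death : Finset P → EReal}

theorem mem_pending {a : ℝ} {K : Finset P} :
    K ∈ pending w d T death a ↔
      K ∈ critical d T ∧ w.weight K ≤ a ∧ (a : EReal) ≤ death K := by
  simp [pending]

theorem mem_dying {a : ℝ} {K : Finset P} :
    K ∈ dying d T death a ↔ K ∈ critical d T ∧ death K = (a : EReal) := by
  simp [dying]

theorem IsDeathAssignment.isLeadingSet (hT : IsMinSpanningTree F w d T)
    (hdeath : IsDeathAssignment F w d T death) {a : ℝ} (ha : a ∈ w.values) :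
    IsLeadingSet ((critBoundaries F w d T a).comap
      (extendCrit F d T (pending w d T death a))) {K | K.1 ∈ dying d T death a} :=
  ((isLeading_iff hT fun _ hK => ⟨(mem_pending.mp hK).1, (mem_pending.mp hK).2.1⟩).mp
    (hdeath.leading a ha)).2

/-- Supplies the unitriangular basis: the dual vector of `K` in the system at its death time, or the
unit vector if `K` never dies. Its other entries are at pending faces that do not die at that time,
hence die later. -/
theorem IsDeathAssignment.exists_killing_boundary (hT : IsMinSpanningTree F w d T)
    (hdeath : IsDeathAssignment F w d T death) (K : Crit d T) :
    ∃ b : Crit d T → F, (∀ t : ℝ, death K.1 ≤ t → b ∈ critBoundaries F w d T t) ∧ b K = 1 ∧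
      ∀ L, L ≠ K → b L ≠ 0 → death K.1 < death L.1 ∧ w.weight L.1 ≤ w.weight K.1 := by
  rcases hdeath.range K.1 K.2 with h | ⟨a, ha, hKa, hda⟩
  · refine ⟨Pi.single K 1, fun t ht => ?_, Pi.single_eq_same _ _, fun L hL hL0 => ?_⟩
    · rw [h] at ht
      exact absurd ht (not_le.mpr (EReal.coe_lt_top t))
    · exact absurd (Pi.single_eq_of_ne (M := fun _ => F) hL 1) hL0
  · have hpend : ∀ L ∈ pending w d T death a, L ∈ critical d T ∧ w.weight L ≤ a :=
      fun L hL => ⟨(mem_pending.mp hL).1, (mem_pending.mp hL).2.1⟩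
    have hKp : K.1 ∈ pending w d T death a := mem_pending.mpr ⟨K.2, hKa, hda.ge⟩
    have hKd : K.1 ∈ dying d T death a := mem_dying.mpr ⟨K.2, hda⟩
    have hlead := hdeath.isLeadingSet hT ha
    obtain ⟨c, hc, hc1, hc0⟩ := hlead.exists_dual (i := ⟨K.1, hKp⟩) hKd
    refine ⟨extendCrit F d T _ c, fun t ht => ?_, ?_, fun L hL hL0 => ?_⟩
    · rw [hda, EReal.coe_le_coe_iff] at ht
      exact critBoundaries_mono ht hc
    · rw [extendCrit_apply, dif_pos hKp, hc1]
    · rw [extendCrit_apply] at hL0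
      have hLp : L.1 ∈ pending w d T death a := by
        by_contra h
        simp [h] at hL0
      rw [dif_pos hLp] at hL0
      have hLd : L.1 ∉ dying d T death a := fun h =>
        hL0 (hc0 ⟨L.1, hLp⟩ h fun h' => hL (Subtype.ext (Subtype.mk.inj h')))
      have hlt : death K.1 < death L.1 := by
        rw [hda]
        exact lt_of_le_of_ne (mem_pending.mp hLp).2.2 fun h =>
          hLd (mem_dying.mpr ⟨L.2, h.symm⟩)
      refine ⟨hlt, ?_⟩
      -- Since `L` could die in place of `K`, the elder rule gives that `L` is no heavier than `K`.
      have hJ := hlead.exchange (i := ⟨K.1, hKp⟩) (j := ⟨L.1, hLp⟩) hKd hLd hc hc0 hL0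
        (J := {M | M.1 ∈ insert L.1 ((dying d T death a).erase K.1)}) (by
          rintro ⟨M, hM⟩
          rw [Set.mem_ofPred_eq, Set.mem_ofPred_eq, Finset.mem_insert, Finset.mem_erase,
            and_comm (a := M ≠ K.1), ne_eq, ne_eq, Subtype.mk.injEq,
            Subtype.mk.injEq])
      have hsub : insert L.1 ((dying d T death a).erase K.1) ⊆ pending w d T death a := by
        refine Finset.insert_subset hLp fun M hM => ?_
        exact (hdeath.leading a ha).1 (Finset.mem_of_mem_erase hM)
      have htot := hdeath.elder a ha _ ((isLeading_iff hT hpend).mpr ⟨hsub, hJ⟩)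
      simp only [Weighting.total] at htot
      rw [Finset.sum_insert fun h => hLd (Finset.mem_of_mem_erase h),
        ← Finset.add_sum_erase _ _ hKd] at htot
      linarith

theorem mem_values {A : Finset P} (hA : A.Nonempty) : w.weight A ∈ w.values :=
  Finset.mem_image_of_mem _ (mem_fullSimplex.mpr hA)

/-- Passing to the last value `a` of the weighting up to `t` does not change the stage. The faces in
the support of `f` are all pending at `a` and none dies there, so `f` vanishes on a leading set. -/
theorem IsDeathAssignment.eq_zero_of_mem_critBoundaries (hT : IsMinSpanningTree F w d T)
    (hdeath : IsDeathAssignment F w d T death) (t : ℝ) (f : Crit d T → F)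
    (hf : f ∈ critBoundaries F w d T t) (h : ∀ K, f K ≠ 0 → (t : EReal) < death K.1) :
    f = 0 := by
  rcases (w.values.filter (· ≤ t)).eq_empty_or_nonempty with he | hne
  · funext K
    by_contra hK
    have h1 := weight_le_of_mem_critBoundaries hf hK
    have h2 : w.weight K.1 ∈ w.values.filter (· ≤ t) := Finset.mem_filter.mpr
      ⟨mem_values (Finset.card_pos.mp (by have := (mem_critical.mp K.2).1; omega)), h1⟩
    simp [he] at h2
  · obtain ⟨a, ha, hmax⟩ := Finset.exists_max_image _ id hne
    simp only [Finset.mem_filter, id_eq] at ha hmax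
    have hst : w.stage t = w.stage a := by
      ext A
      simp only [mem_stage]
      refine and_congr_right fun hA => ⟨fun h' => hmax _ ⟨mem_values hA, h'⟩, fun h' => h'.trans ha.2⟩
    have hfa : f ∈ critBoundaries F w d T a := by
      simpa only [critBoundaries, hst] using hf
    have hp : ∀ K, f K ≠ 0 → K.1 ∈ pending w d T death a := fun K hK => mem_pending.mpr
      ⟨K.2, weight_le_of_mem_critBoundaries hfa hK,
        (EReal.coe_le_coe_iff.mpr ha.2).trans (h K hK).le⟩
    set c : {K // K ∈ pending w d T death a} → F :=
      fun K => f ⟨K.1, (mem_pending.mp K.2).1⟩ with hc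
    have hcf : extendCrit F d T _ c = f := by
      funext K
      rw [extendCrit_apply]
      split_ifs with hK
      · rfl
      · by_contra h'
        exact hK (hp K fun h0 => h' h0.symm)
    have hc0 : c = 0 := by
      refine (hdeath.isLeadingSet hT ha.1).eq_zero (c := c) ?_ fun K hK => ?_
      · rwa [Submodule.mem_comap, hcf]
      · by_contra h'
        have h1 := h _ h'
        have h2 : death K.1 = a := (mem_dying.mp hK).2
        rw [h2, EReal.coe_lt_coe_iff] at h1
        exact absurd ha.2 (not_le.mpr h1)
    rw [← hcf, hc0, map_zero]

/-- Coordinates on the `d`-cycles of the simplex which are adapted to the birth and death times: the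
cycles of the stage at `t` are those with coordinates in the faces born by `t`, and the boundaries
are those with coordinates in the faces dead by `t`. -/
structure IsAdapted (w : Weighting P) (d : ℕ) (T : Finset (Finset P)) (death : Finset P → EReal)
    (Θ : (Crit d T → F) ≃ₗ[F] (Crit d T → F)) : Prop where
  weight_iff : ∀ (t : ℝ) f, (∀ K, Θ f K ≠ 0 → w.weight K.1 ≤ t) ↔
    ∀ K, f K ≠ 0 → w.weight K.1 ≤ t
  mem_iff : ∀ (t : ℝ) f, (∀ K, Θ f K ≠ 0 → death K.1 ≤ (t : EReal)) ↔
    f ∈ critBoundaries F w d T t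
  death_iff : ∀ (t : ℝ) f, (∀ K, Θ f K ≠ 0 → (t : EReal) < death K.1) ↔
    ∀ K, f K ≠ 0 → (t : EReal) < death K.1
  apply_single : ∀ K, Θ (Pi.single K 1) K = 1

theorem IsDeathAssignment.exists_isAdapted (hT : IsMinSpanningTree F w d T)
    (hdeath : IsDeathAssignment F w d T death) :
    ∃ Θ : (Crit d T → F) ≃ₗ[F] (Crit d T → F), IsAdapted w d T death Θ := by
  obtain ⟨Θ, h1, h2, h3, h4⟩ := exists_adapted_coordinates (fun K : Crit d T => w.weight K.1)
    (fun K => death K.1) (critBoundaries F w d T) (hdeath.exists_killing_boundary hT)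
    (hdeath.eq_zero_of_mem_critBoundaries hT)
  exact ⟨Θ, h1, h2, h3, h4⟩

end Deaths

/-! ### Ranks, the persistence diagram and an interval decomposition -/

section Persistence

variable {F : Type*} [Field F] {P : Type*} [Fintype P] [LinearOrder P]
variable {w : Weighting P} {d : ℕ} {T : Finset (Finset P)} {death : Finset P → EReal}
variable {Θ : (Crit d T → F) ≃ₗ[F] (Crit d T → F)}

variable (death Θ) in
/-- The coordinates at the faces which die after `t`. -/
noncomputable def lateCoords (t : ℝ) : (Crit d T → F) →ₗ[F] (Crit d T → F) :=
  LinearMap.pi fun K => if (t : EReal) < death K.1 then LinearMap.proj K ∘ₗ Θ.toLinearMap else 0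

theorem lateCoords_apply (t : ℝ) (f : Crit d T → F) (K : Crit d T) :
    lateCoords death Θ t f K = if (t : EReal) < death K.1 then Θ f K else 0 := by
  simp only [lateCoords, LinearMap.pi_apply]
  split_ifs <;> rfl

theorem lateCoords_eq_zero_iff (hΘ : IsAdapted w d T death Θ) {t : ℝ} {f : Crit d T → F} :
    lateCoords death Θ t f = 0 ↔ f ∈ critBoundaries F w d T t := by
  rw [← hΘ.mem_iff, funext_iff]
  refine forall_congr' fun K => ?_
  rw [lateCoords_apply, Pi.zero_apply, ← not_lt]
  by_cases h : (t : EReal) < death K.1 <;> simp [h]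

/-- The isomorphism from `H_d` of the stage at `t` to the functions on the critical faces which are
supported on the faces alive at `t`. -/
noncomputable def aliveCoords (hΘ : IsAdapted w d T death Θ) (t : ℝ) :
    Homology F (d : ℤ) (w.stage t) →ₗ[F] (Crit d T → F) :=
  Submodule.liftQ _ (lateCoords death Θ t ∘ₗ critCoeffs F d T ∘ₗ Submodule.subtype _) <| by
    rintro ⟨z, hz⟩ hzb
    obtain ⟨c, hc, rfl⟩ := mem_relBoundaries_empty.mp hzb
    exact (lateCoords_eq_zero_iff hΘ).mpr ⟨_, ⟨c, hc, rfl⟩, rfl⟩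

variable (hΘ : IsAdapted w d T death Θ)

theorem aliveCoords_relClass {t : ℝ} {z : Finset P → F}
    (hz : z ∈ relCycles F d (w.stage t) ∅) :
    aliveCoords hΘ t (relClass F d (w.stage t) ∅ z) =
      lateCoords death Θ t (critCoeffs F d T z) := by
  rw [relClass_eq_mk hz]
  rfl

/-- Coordinates at faces that die after `t` all vanish only for elements of the boundary space at
`t`. -/
theorem aliveCoords_injective (hT : IsMinSpanningTree F w d T) (t : ℝ) :
    Function.Injective (aliveCoords hΘ t) := by
  rw [injective_iff_map_eq_zero]
  intro x hx
  obtain ⟨z, hz, rfl⟩ := exists_relClass_eq x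
  rw [aliveCoords_relClass hΘ hz, lateCoords_eq_zero_iff hΘ] at hx
  have h := mem_relCycles_empty.mp hz
  rw [relClass_eq_zero_iff hz, mem_relBoundaries_empty]
  exact (critCoeffs_mem_critBoundaries_iff hT
    (chains_mono (stage_subset_fullSimplex w t) h.1) h.2).mp hx

theorem alive_of_aliveCoords_ne_zero {t : ℝ} {x : Homology F (d : ℤ) (w.stage t)} {K : Crit d T}
    (hK : aliveCoords hΘ t x K ≠ 0) : w.weight K.1 ≤ t ∧ (t : EReal) < death K.1 := by
  obtain ⟨z, hz, rfl⟩ := exists_relClass_eq x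
  rw [aliveCoords_relClass hΘ hz, lateCoords_apply] at hK
  have h : (t : EReal) < death K.1 := by
    by_contra h
    simp [h] at hK
  rw [if_pos h] at hK
  exact ⟨(hΘ.weight_iff t _).mpr (fun L hL => (mem_stage.mp (hz.1 L.1 hL).1).2) K hK, h⟩

theorem critCycle_mem_relCycles (hT : IsMinSpanningTree F w d T) {t : ℝ} {f : Crit d T → F}
    (hf : ∀ K, f K ≠ 0 → w.weight K.1 ≤ t) :
    critCycle hT f ∈ relCycles F d (w.stage t) ∅ :=
  mem_relCycles_empty.mpr ⟨critCycle_mem_chains_stage hT hf, boundary_critCycle hT f⟩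

theorem exists_aliveCoords_eq (hT : IsMinSpanningTree F w d T) {t : ℝ} {f : Crit d T → F}
    (hf : ∀ K, f K ≠ 0 → w.weight K.1 ≤ t ∧ (t : EReal) < death K.1) :
    ∃ x, aliveCoords hΘ t x = f := by
  have h1 : ∀ K, Θ.symm f K ≠ 0 → w.weight K.1 ≤ t := by
    rw [← hΘ.weight_iff, LinearEquiv.apply_symm_apply]
    exact fun K hK => (hf K hK).1
  refine ⟨relClass F d (w.stage t) ∅ (critCycle hT (Θ.symm f)), ?_⟩
  rw [aliveCoords_relClass hΘ (critCycle_mem_relCycles hT h1), critCoeffs_critCycle]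
  funext K
  rw [lateCoords_apply, LinearEquiv.apply_symm_apply]
  split_ifs with h
  · rfl
  · by_contra h'
    exact h (hf K fun h0 => h' h0.symm).2

/-- In adapted coordinates every transition map just forgets the faces that have died, so the
persistence module is visibly a sum of intervals. -/
theorem aliveCoords_homMap {s t : ℝ} (hst : s ≤ t) (x : Homology F (d : ℤ) (w.stage s))
    (K : Crit d T) :
    aliveCoords hΘ t (homMap F d (w.stage s) (w.stage t) x) K =
      if (t : EReal) < death K.1 then aliveCoords hΘ s x K else 0 := by
  obtain ⟨z, hz, rfl⟩ := exists_relClass_eq x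
  rw [homMap, relMap_relClass (stage_mono w hst) subset_rfl hz, aliveCoords_relClass hΘ hz,
    aliveCoords_relClass hΘ (relCycles_mono (stage_mono w hst) subset_rfl hz), lateCoords_apply,
    lateCoords_apply]
  split_ifs with h1 h2
  · rfl
  · exact absurd ((EReal.coe_le_coe_iff.mpr hst).trans_lt h1) h2
  · rfl

theorem finrank_span_single {κ : Type*} [Fintype κ] [DecidableEq κ] (S : Finset κ) :
    Module.finrank F (Submodule.span F ((fun k : κ => (Pi.single k 1 : κ → F)) '' S)) =
      S.card := by
  have h := (Pi.basisFun F κ).linearIndependent.comp (Subtype.val : S → κ)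
    Subtype.val_injective
  have h2 := finrank_span_eq_card h
  have h3 : Set.range (⇑(Pi.basisFun F κ) ∘ (Subtype.val : S → κ)) =
      (fun k : κ => (Pi.single k 1 : κ → F)) '' S := by
    ext x
    simp
  rwa [Fintype.card_coe, h3] at h2

theorem mem_of_forall_single {κ : Type*} [Fintype κ] [DecidableEq κ] (N : Submodule F (κ → F))
    {c : κ → F} (h : ∀ k, c k ≠ 0 → Pi.single k 1 ∈ N) : c ∈ N :=
  map_mem_of_forall_single LinearMap.id N h

include hΘ in
theorem rank_stage_stage (hT : IsMinSpanningTree F w d T) {s t : ℝ} (hst : s ≤ t) :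
    rank F d (w.stage s) (w.stage t) = (Finset.univ.filter fun K : Crit d T =>
      w.weight K.1 ≤ s ∧ (t : EReal) < death K.1).card := by
  rw [← finrank_span_single (F := F), rank,
    (Submodule.equivMapOfInjective _ (aliveCoords_injective hΘ hT t) _).finrank_eq]
  refine congrArg (fun N : Submodule F (Crit d T → F) => Module.finrank F N)
    (le_antisymm ?_ ?_)
  · rintro _ ⟨_, ⟨x, rfl⟩, rfl⟩
    refine mem_of_forall_single _ fun K hK => Submodule.subset_span ⟨K, ?_, rfl⟩
    rw [aliveCoords_homMap hΘ hst] at hK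
    have h : (t : EReal) < death K.1 := by
      by_contra h
      simp [h] at hK
    rw [if_pos h] at hK
    simpa using ⟨(alive_of_aliveCoords_ne_zero hΘ hK).1, h⟩
  · rw [Submodule.span_le]
    rintro _ ⟨K, hK, rfl⟩
    have hK' : w.weight K.1 ≤ s ∧ (t : EReal) < death K.1 := by simpa using hK
    obtain ⟨x, hx⟩ := exists_aliveCoords_eq hΘ hT (t := s) (f := Pi.single K 1) (fun L hL => by
      obtain rfl : L = K := by
        by_contra h
        exact hL (Pi.single_eq_of_ne (M := fun _ => F) h 1)
      exact ⟨hK'.1, (EReal.coe_le_coe_iff.mpr hst).trans_lt hK'.2⟩)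
    refine ⟨_, ⟨x, rfl⟩, funext fun L => ?_⟩
    rw [aliveCoords_homMap hΘ hst, hx]
    split_ifs with h
    · rfl
    · have : L ≠ K := fun h' => h (h' ▸ hK'.2)
      exact (Pi.single_eq_of_ne (M := fun _ => F) this 1).symm

/-- Only finitely many weights occur, so a stage just before `q` is an ordinary stage and
`rank_stage_stage` applies to it. -/
theorem exists_lt_forall_values (w : Weighting P) (q : ℝ) :
    ∃ q' < q, ∀ v ∈ w.values, v < q ↔ v ≤ q' := by
  rcases (w.values.filter (· < q)).eq_empty_or_nonempty with he | hne
  · refine ⟨q - 1, by linarith, fun v hv => ⟨fun h => ?_, fun h => by linarith⟩⟩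
    have : v ∈ w.values.filter (· < q) := Finset.mem_filter.mpr ⟨hv, h⟩
    simp [he] at this
  · obtain ⟨a, ha, hmax⟩ := Finset.exists_max_image _ id hne
    simp only [Finset.mem_filter, id_eq] at ha hmax
    exact ⟨a, ha.2, fun v hv => ⟨fun h => hmax v ⟨hv, h⟩, fun h => h.trans_lt ha.2⟩⟩

theorem stageBefore_eq_stage {q q' : ℝ} (h : ∀ v ∈ w.values, v < q ↔ v ≤ q') :
    w.stageBefore q = w.stage q' := by
  ext A
  rw [Weighting.stageBefore, Finset.mem_filter, mem_fullSimplex, mem_stage]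
  exact and_congr_right fun hA => h _ (mem_values hA)

theorem weight_mem_values (K : Crit d T) : w.weight K.1 ∈ w.values :=
  mem_values (Finset.card_pos.mp (by have := (mem_critical.mp K.2).1; omega))

theorem IsDeathAssignment.lt_death_iff (hdeath : IsDeathAssignment F w d T death) {q q' : ℝ}
    (h : ∀ v ∈ w.values, v < q ↔ v ≤ q') (K : Crit d T) :
    (q' : EReal) < death K.1 ↔ (q : EReal) ≤ death K.1 := by
  rcases hdeath.range K.1 K.2 with hK | ⟨a, ha, -, hK⟩
  · simp [hK, EReal.coe_lt_top]
  · rw [hK, EReal.coe_lt_coe_iff, EReal.coe_le_coe_iff, ← not_le, ← h a ha, not_lt]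

include hΘ in
-- Each rank counts faces born by the first scale and still alive at the second; the alternating sum
-- isolates those born exactly at `p` and dying exactly at `q`.
theorem dotMult_eq (hT : IsMinSpanningTree F w d T) (hdeath : IsDeathAssignment F w d T death)
    {p q : ℝ} (hp : p ∈ w.values) (hpq : p < q) :
    dotMult F w d p q = (Finset.univ.filter fun K : Crit d T =>
      w.weight K.1 = p ∧ death K.1 = (q : EReal)).card := by
  obtain ⟨p', hp', hpv⟩ := exists_lt_forall_values w p
  obtain ⟨q', hq', hqv⟩ := exists_lt_forall_values w q
  have hpq' : p ≤ q' := (hqv p hp).mp hpq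
  have hle : ∀ s, s ≤ p → rank F d (w.stage s) (w.stage q') =
      (Finset.univ.filter fun K : Crit d T =>
        w.weight K.1 ≤ s ∧ death K.1 = (q : EReal)).card + rank F d (w.stage s) (w.stage q) := by
    intro s hs
    rw [rank_stage_stage hΘ hT (hs.trans hpq'), rank_stage_stage hΘ hT (hs.trans hpq.le),
      ← Finset.card_union_of_disjoint]
    · congr 1
      ext K
      simp only [Finset.mem_filter, Finset.mem_univ, true_and, Finset.mem_union,
        hdeath.lt_death_iff hqv, ← and_or_left, le_iff_eq_or_lt (a := (q : EReal)),
        eq_comm (a := (q : EReal))]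
    · rw [Finset.disjoint_filter]
      intro K _ h1 h2
      exact h2.2.ne' h1.2
  have hsplit : (Finset.univ.filter fun K : Crit d T =>
        w.weight K.1 ≤ p ∧ death K.1 = (q : EReal)).card =
      (Finset.univ.filter fun K : Crit d T =>
        w.weight K.1 = p ∧ death K.1 = (q : EReal)).card +
      (Finset.univ.filter fun K : Crit d T =>
        w.weight K.1 ≤ p' ∧ death K.1 = (q : EReal)).card := by
    rw [← Finset.card_union_of_disjoint]
    · congr 1
      ext K
      simp only [Finset.mem_filter, Finset.mem_univ, true_and, Finset.mem_union,
        ← hpv _ (weight_mem_values K), ← or_and_right, le_iff_eq_or_lt (b := p)]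
    · rw [Finset.disjoint_filter]
      intro K _ h1 h2
      have := h1.1 ▸ h2.1
      linarith
  rw [dotMult, stageBefore_eq_stage hpv, stageBefore_eq_stage hqv, hle p le_rfl, hle p' hp'.le,
    hsplit]
  push_cast
  omega

include hΘ in
theorem dotMultTop_eq (hT : IsMinSpanningTree F w d T)
    (hdeath : IsDeathAssignment F w d T death) {p : ℝ} (hp : p ∈ w.values) :
    dotMultTop F w d p = (Finset.univ.filter fun K : Crit d T =>
      w.weight K.1 = p ∧ death K.1 = ⊤).card := by
  obtain ⟨p', hp', hpv⟩ := exists_lt_forall_values w p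
  obtain ⟨M, hM⟩ := w.values.exists_le
  -- Past all weights the stage is the whole simplex, and surviving there means never dying.
  have hfull : fullSimplex P = w.stage M := by
    ext A
    rw [mem_stage, mem_fullSimplex]
    exact ⟨fun h => ⟨h, hM _ (mem_values h)⟩, And.left⟩
  have htop : ∀ K : Crit d T, (M : EReal) < death K.1 ↔ death K.1 = ⊤ := by
    intro K
    rcases hdeath.range K.1 K.2 with hK | ⟨a, ha, -, hK⟩
    · simp [hK, EReal.coe_lt_top]
    · rw [hK, EReal.coe_lt_coe_iff]
      simpa using hM a ha
  have hsplit : rank F d (w.stage p) (w.stage M) =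
      (Finset.univ.filter fun K : Crit d T => w.weight K.1 = p ∧ death K.1 = ⊤).card +
        rank F d (w.stage p') (w.stage M) := by
    rw [rank_stage_stage hΘ hT (hM p hp), rank_stage_stage hΘ hT (hp'.le.trans (hM p hp)),
      ← Finset.card_union_of_disjoint]
    · congr 1
      ext K
      simp only [Finset.mem_filter, Finset.mem_univ, true_and, Finset.mem_union, htop,
        ← hpv _ (weight_mem_values K), ← or_and_right, le_iff_eq_or_lt (b := p)]
    · rw [Finset.disjoint_filter]
      intro K _ h1 h2
      have := h1.1 ▸ h2.1
      linarith
  rw [dotMultTop, stageBefore_eq_stage hpv, hfull, hsplit]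
  push_cast
  omega

theorem replicate_card_filter {κ β : Type*} (S : Finset κ) (p : κ → Prop) [DecidablePred p]
    (x : β) :
    Multiset.replicate (S.filter p).card x = ∑ k ∈ S, if p k then {x} else 0 := by
  rw [← Finset.sum_filter, Finset.sum_const, Multiset.nsmul_singleton]

include hΘ in
theorem diagram_eq (hT : IsMinSpanningTree F w d T)
    (hdeath : IsDeathAssignment F w d T death) :
    diagram F w d = (Finset.univ.filter fun K : Crit d T =>
      (w.weight K.1 : EReal) < death K.1).val.map
        fun K => ((w.weight K.1 : EReal), death K.1) := by
  have h1 : diagram F w d = ∑ p ∈ w.values,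
      ((∑ q ∈ w.values.filter (fun q => p < q), ∑ K : Crit d T,
        if w.weight K.1 = p ∧ death K.1 = (q : EReal) then {((p : EReal), (q : EReal))} else 0) +
      ∑ K : Crit d T,
        if w.weight K.1 = p ∧ death K.1 = ⊤ then {((p : EReal), (⊤ : EReal))} else 0) := by
    refine Finset.sum_congr rfl fun p hp => ?_
    congr 1
    · refine Finset.sum_congr rfl fun q hq => ?_
      rw [dotMult_eq hΘ hT hdeath hp (Finset.mem_filter.mp hq).2, replicate_card_filter]
    · rw [dotMultTop_eq hΘ hT hdeath hp, replicate_card_filter]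
  have h2 : ∀ K : Crit d T, (∑ p ∈ w.values,
      ((∑ q ∈ w.values.filter (fun q => p < q),
        if w.weight K.1 = p ∧ death K.1 = (q : EReal) then {((p : EReal), (q : EReal))} else 0) +
      if w.weight K.1 = p ∧ death K.1 = ⊤ then {((p : EReal), (⊤ : EReal))} else 0)) =
      (if (w.weight K.1 : EReal) < death K.1 then
        {((w.weight K.1 : EReal), death K.1)} else 0 : Multiset (EReal × EReal)) := by
    intro K
    -- A face contributes only at `p = w(K)` and `q` equal to its death; the condition `p < q`
    -- removes the faces of zero lifespan.
    rw [Finset.sum_eq_single (w.weight K.1) _ fun h => absurd (weight_mem_values K) h]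
    · simp only [true_and]
      rcases hdeath.range K.1 K.2 with hK | ⟨a, ha, -, hK⟩
      · simp [hK, EReal.coe_lt_top]
      · simp only [hK, EReal.coe_ne_top, if_false, add_zero, EReal.coe_lt_coe_iff,
          EReal.coe_eq_coe_iff]
        rw [Finset.sum_ite_eq]
        simp [ha]
    · intro p _ hp
      simp [hp.symm]
  rw [h1]
  simp only [Finset.sum_comm (t := (Finset.univ : Finset (Crit d T))), ← Finset.sum_add_distrib]
  simp only [h2]
  rw [← Finset.sum_filter, Finset.sum_eq_multiset_sum]
  conv_rhs => rw [← Multiset.sum_map_singleton (Multiset.map _ _), Multiset.map_map]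
  rfl

include hΘ in
/-- The dots of the persistence diagram correspond to the critical faces of positive lifespan. -/
theorem exists_dotEquiv (hT : IsMinSpanningTree F w d T)
    (hdeath : IsDeathAssignment F w d T death) :
    ∃ ε : {K : Crit d T // (w.weight K.1 : EReal) < death K.1} ≃ Dot F w d,
      ∀ K, (ε K).1 = ((w.weight K.1.1 : EReal), death K.1.1) := by
  -- The bijection is built fibrewise: every pair is the label of as many faces as its multiplicity
  -- in the diagram.
  have key : ∀ c : EReal × EReal, Nonempty
      ({K : {K : Crit d T // (w.weight K.1 : EReal) < death K.1} //
        ((w.weight K.1.1 : EReal), death K.1.1) = c} ≃ {x : Dot F w d // x.1 = c}) := by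
    intro c
    have h : (diagram F w d).count c = Fintype.card
        {K : {K : Crit d T // (w.weight K.1 : EReal) < death K.1} //
          ((w.weight K.1.1 : EReal), death K.1.1) = c} := by
      rw [diagram_eq hΘ hT hdeath, Multiset.count_map, ← Finset.filter_val, Finset.card_val,
        Finset.filter_filter, ← Fintype.card_subtype]
      refine Fintype.card_congr ((Equiv.subtypeEquivRight fun K => ?_).trans
        (Equiv.subtypeSubtypeEquivSubtypeInter
          (fun K : Crit d T => (w.weight K.1 : EReal) < death K.1)
          (fun K => ((w.weight K.1 : EReal), death K.1) = c)).symm)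
      rw [eq_comm (a := c)]
    exact ⟨(Fintype.equivFinOfCardEq h.symm).trans 
      (Equiv.sigmaSubtype (β := fun c => Fin ((diagram F w d).count c)) c).symm⟩
  exact ⟨Equiv.ofFiberEquiv (f := fun K => ((w.weight K.1.1 : EReal), death K.1.1))
    (g := fun x : Dot F w d => x.1) fun c => (key c).some, fun K => Equiv.ofFiberEquiv_map _ K⟩

/-- Generators of the intervals, given by their coordinates. -/
theorem exists_generators (hT : IsMinSpanningTree F w d T)
    (ε : {K : Crit d T // (w.weight K.1 : EReal) < death K.1} ≃ Dot F w d)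
    (hε : ∀ K, (ε K).1 = ((w.weight K.1.1 : EReal), death K.1.1)) :
    ∃ gen : Dot F w d → (t : ℝ) → Homology F (d : ℤ) (w.stage t),
      IsIntervalDecomposition F w d gen ∧
      ∀ x t, AliveAt x.1 t → aliveCoords hΘ t (gen x t) = Pi.single (ε.symm x).1 1 := by
  classical
  have hlabel : ∀ x : Dot F w d,
      x.1 = ((w.weight (ε.symm x).1.1 : EReal), death (ε.symm x).1.1) := fun x => by
    rw [← hε, ε.apply_symm_apply]
  have halive : ∀ (x : Dot F w d) (t : ℝ), AliveAt x.1 t ↔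
      w.weight (ε.symm x).1.1 ≤ t ∧ (t : EReal) < death (ε.symm x).1.1 := fun x t => by
    rw [AliveAt, hlabel x, EReal.coe_le_coe_iff]
  have hex : ∀ (x : Dot F w d) (t : ℝ), ∃ y, aliveCoords hΘ t y =
      if AliveAt x.1 t then Pi.single (ε.symm x).1 1 else 0 := by
    intro x t
    refine exists_aliveCoords_eq hΘ hT fun K hK => ?_
    by_cases hx : AliveAt x.1 t
    · rw [if_pos hx] at hK
      obtain rfl : K = (ε.symm x).1 := by
        by_contra h
        exact hK (Pi.single_eq_of_ne (M := fun _ => F) h 1)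
      exact (halive x t).mp hx
    · simp [hx] at hK
  choose gen hgen using hex
  have hinj := aliveCoords_injective hΘ hT
  refine ⟨gen, ⟨fun x t hx => hinj t ?_, fun x s t hxs hst => hinj t (funext fun K => ?_),
    fun t => ?_, fun t => ?_⟩, fun x t hx => by rw [hgen, if_pos hx]⟩
  · rw [hgen, if_neg hx, map_zero]
  · rw [aliveCoords_homMap hΘ hst, hgen, hgen]
    have hxs' : w.weight (ε.symm x).1.1 ≤ s := by
      rw [hlabel x] at hxs
      exact EReal.coe_le_coe_iff.mp hxs
    simp only [halive, hxs', hxs'.trans hst, true_and]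
    by_cases hK : K = (ε.symm x).1
    · subst hK
      by_cases h1 : (t : EReal) < death (ε.symm x).1.1
      · have h2 : (s : EReal) < death (ε.symm x).1.1 :=
          (EReal.coe_le_coe_iff.mpr hst).trans_lt h1
        simp [h1, h2]
      · simp [h1]
    · split_ifs <;> simp [hK]
  · refine LinearIndependent.of_comp (aliveCoords hΘ t) ?_
    have := (Pi.basisFun F (Crit d T)).linearIndependent.comp
      (fun x : {x : Dot F w d // AliveAt x.1 t} => (ε.symm x.1).1)
      (Subtype.val_injective.comp (ε.symm.injective.comp Subtype.val_injective))
    convert this using 1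
    funext x
    simp [hgen, x.2]
  · refine eq_top_iff.mpr fun y _ => ?_
    have h1 : aliveCoords hΘ t y ∈ (Submodule.span F (Set.range
        fun x : {x : Dot F w d // AliveAt x.1 t} => gen x.1 t)).map (aliveCoords hΘ t) := by
      refine mem_of_forall_single _ fun K hK => ?_
      have hK' := alive_of_aliveCoords_ne_zero hΘ hK
      have hx : AliveAt (ε ⟨K, (EReal.coe_le_coe_iff.mpr hK'.1).trans_lt hK'.2⟩).1 t := by
        rw [halive]
        simpa using hK'
      refine ⟨_, Submodule.subset_span ⟨⟨_, hx⟩, rfl⟩, ?_⟩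
      simp [hgen, hx]
    obtain ⟨y', hy', hyy⟩ := h1
    rwa [← hinj t hyy]

end Persistence

/-! ### The reduced skeleton is a fitting spanning subcomplex -/

section ReducedSkeleton

variable {F : Type*} [Field F] {P : Type*} [Fintype P] [LinearOrder P]
variable {w : Weighting P} {d : ℕ} {T : Finset (Finset P)} {death : Finset P → EReal} {α : ℝ}
variable {Θ : (Crit d T → F) ≃ₗ[F] (Crit d T → F)}

theorem mem_reducedSkeleton {A : Finset P} :
    A ∈ reducedSkeleton w d T death α ↔
      w.weight A ≤ α ∧ (A ∈ T ∨ A ∈ critical d T ∧ (α : EReal) < death A) := by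
  have hcrit : A ∈ critical d T → A ∉ T := fun h => (mem_critical.mp h).2
  classical
  unfold reducedSkeleton
  rw [Finset.mem_filter, skeleton, Finset.mem_union, Finset.mem_filter]
  by_cases hA : A ∈ T
  · simp [label, AliveAt, hA, EReal.coe_lt_top]
  · simp only [label, AliveAt, hA, false_or, if_false, EReal.coe_le_coe_iff]
    constructor
    · rintro ⟨⟨h1, -⟩, h2, h3⟩
      exact ⟨h2, h1, h3⟩
    · rintro ⟨h2, h1, h3⟩
      exact ⟨⟨h1, (EReal.coe_le_coe_iff.mpr h2).trans_lt h3⟩, h2, h3⟩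

theorem mem_facesOff_reducedSkeleton {S : Finset P} :
    S ∈ facesOff d (reducedSkeleton w d T death α) (w.reduced T α) ↔
      S ∈ critical d T ∧ w.weight S ≤ α ∧ (α : EReal) < death S := by
  simp only [facesOff, Finset.mem_filter, mem_reducedSkeleton, mem_reduced, mem_critical]
  tauto

theorem reduced_subset_reducedSkeleton : w.reduced T α ⊆ reducedSkeleton w d T death α := by
  intro A hA
  have := mem_reduced.mp hA
  exact mem_reducedSkeleton.mpr ⟨this.2, Or.inl this.1⟩

variable (hT : IsMinSpanningTree F w d T)

include hT in
theorem dimLE_reducedSkeleton : DimLE d (reducedSkeleton w d T death α) := by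
  intro A hA
  rcases (mem_reducedSkeleton.mp hA).2 with h | h
  · exact hT.1.1.1.2.1 A h
  · exact (mem_critical.mp h.1).1.le

include hT in
theorem reducedSkeleton_subset_stage : reducedSkeleton w d T death α ⊆ w.stage α := by
  intro A hA
  obtain ⟨h1, h2 | h2⟩ := mem_reducedSkeleton.mp hA
  · exact mem_stage.mpr ⟨(hT.1.1.1.1 h2).1, h1⟩
  · exact mem_stage.mpr
      ⟨Finset.card_pos.mp (by have := (mem_critical.mp h2.1).1; omega), h1⟩

include hT in
theorem isSpanning_reducedSkeleton :
    IsSpanning d (reducedSkeleton w d T death α) (w.stage α) := by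
  refine fun A hA => ⟨fun h => reducedSkeleton_subset_stage hT h, fun h => ?_⟩
  have := mem_stage.mp h
  exact mem_reducedSkeleton.mpr
    ⟨this.2, Or.inl ((hT.1.2 A hA).mpr (mem_fullSimplex.mpr this.1))⟩

include hT in
theorem isComplex_reducedSkeleton : IsComplex (reducedSkeleton w d T death α) := by
  intro A hA
  have hAs := reducedSkeleton_subset_stage hT hA
  refine ⟨(mem_stage.mp hAs).1, fun B hB hBne => ?_⟩
  rcases eq_or_ne B A with rfl | hne
  · exact hA
  · have h1 := Finset.card_lt_card (Finset.ssubset_iff_subset_ne.mpr ⟨hB, hne⟩)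
    have h2 := dimLE_reducedSkeleton hT A hA
    exact (isSpanning_reducedSkeleton hT B (by omega)).mpr
      ((isComplex_stage w α hAs).2 hB hBne)

theorem mem_chains_of_isSpanning {k : ℤ} {C X : Finset (Finset P)} (h : IsSpanning d C X)
    (hk : k < d) {c : Finset P → F} (hc : c ∈ chains F k X) : c ∈ chains F k C := by
  intro A hA
  have := hc A hA
  exact ⟨(h A (by omega)).mpr this.1, this.2⟩

include hT in
-- Below degree `d` both complexes have the same cycles, and boundaries could differ only through
-- `d`-faces missing from `C`. Such a face has the boundary of its tree chain, which is no heavier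
-- and so lies in `C`.
theorem homMap_bijective_of_lt {C : Finset (Finset P)} (hTC : w.reduced T α ⊆ C)
    (hCX : C ⊆ w.stage α) (hs : IsSpanning d C (w.stage α)) {i : ℕ} (hi : i < d) :
    Function.Bijective (homMap F (i : ℤ) C (w.stage α)) := by
  refine ⟨(homMap_injective_iff hCX).mpr ?_, (homMap_surjective_iff hCX).mpr ?_⟩
  · rintro _ - - ⟨c, hc, rfl⟩
    refine map_mem_of_forall_single (boundary F) ((chains F ((i : ℤ) + 1) C).map (boundary F))
      fun A hA => ?_
    have h := hc A hA
    by_cases hAd : A.card ≤ d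
    · exact ⟨_, single_mem_chains ((hs A hAd).mpr h.1) h.2 1, rfl⟩
    · have hid : (i : ℤ) + 1 = d := by omega
      obtain ⟨τ, hτ, hb, hw⟩ := hT.exists_boundary_eq_single A (by omega)
      refine ⟨τ, fun B hB => ?_, hb⟩
      rw [hid]
      exact ⟨hTC (mem_reduced.mpr ⟨(hτ B hB).1, (hw B hB).trans (mem_stage.mp h.1).2⟩),
        (hτ B hB).2⟩
  · intro z hz hz0
    exact ⟨z, mem_chains_of_isSpanning hs (by omega) hz, hz0, 0, Submodule.zero_mem _, by simp⟩

theorem chains_succ_eq_bot {C : Finset (Finset P)} (hC : DimLE d C) :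
    chains F ((d : ℤ) + 1) C = ⊥ :=
  chains_eq_bot fun A hA h => by
    have := hC A hA
    omega

variable (hΘ : IsAdapted w d T death Θ)

include hΘ in
-- With `late_eq_self`, this says that `Θ.symm ∘ lateCoords` is a projection along the boundaries at
-- `α` onto the functions supported on faces dying after `α`, and that it respects every stage `t`.
theorem exists_late_add_boundary {t : ℝ} (f : Crit d T → F) (hf : ∀ K, f K ≠ 0 → w.weight K.1 ≤ t)
    (α : ℝ) :
    (∀ K, Θ.symm (lateCoords death Θ α f) K ≠ 0 →
      w.weight K.1 ≤ t ∧ (α : EReal) < death K.1) ∧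
    f - Θ.symm (lateCoords death Θ α f) ∈ critBoundaries F w d T α := by
  refine ⟨fun K hK => ⟨(hΘ.weight_iff t _).mp (fun L hL => ?_) K hK,
    (hΘ.death_iff α _).mp (fun L hL => ?_) K hK⟩, (hΘ.mem_iff α _).mp fun K hK => ?_⟩
  · rw [LinearEquiv.apply_symm_apply, lateCoords_apply] at hL
    exact (hΘ.weight_iff t f).mpr hf L (ite_ne_right_iff.mp hL).2
  · rw [LinearEquiv.apply_symm_apply, lateCoords_apply] at hL
    exact (ite_ne_right_iff.mp hL).1
  · rw [map_sub, LinearEquiv.apply_symm_apply, Pi.sub_apply, lateCoords_apply] at hK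
    by_contra h
    simp [not_le.mp h] at hK

include hΘ in
theorem late_eq_self {f : Crit d T → F} (hf : ∀ K, f K ≠ 0 → (α : EReal) < death K.1) :
    Θ.symm (lateCoords death Θ α f) = f := by
  rw [LinearEquiv.symm_apply_eq]
  funext K
  rw [lateCoords_apply]
  split_ifs with h
  · rfl
  · by_contra h'
    exact h ((hΘ.death_iff α f).mpr hf K fun h0 => h' h0.symm)

include hT hΘ in
-- Cycles of the skeleton are fixed by the projection along the boundaries, so a bounding one is
-- zero; and any cycle of the stage is homologous to its projection, which lives on the skeleton.
theorem homMap_reducedSkeleton_bijective :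
    Function.Bijective (homMap F (d : ℤ) (reducedSkeleton w d T death α) (w.stage α)) := by
  have hCX := reducedSkeleton_subset_stage (α := α) (death := death) hT
  refine ⟨(homMap_injective_iff hCX).mpr ?_, (homMap_surjective_iff hCX).mpr ?_⟩
  · intro z hz hz0 hb
    have hzX := chains_mono ((hCX).trans (stage_subset_fullSimplex w α)) hz
    have h1 := (critCoeffs_mem_critBoundaries_iff hT hzX hz0).mpr hb
    have h2 : lateCoords death Θ α (critCoeffs F d T z) = 0 := (lateCoords_eq_zero_iff hΘ).mpr h1
    have h3 := late_eq_self (α := α) hΘ (f := critCoeffs F d T z) fun K hK =>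
      ((mem_reducedSkeleton.mp (hz K.1 hK).1).2.resolve_left (mem_critical.mp K.2).2).2
    rw [h2, map_zero] at h3
    refine ⟨0, Submodule.zero_mem _, ?_⟩
    rw [← critCycle_critCoeffs hT hzX hz0, ← h3, map_zero, map_zero]
  · intro z hz hz0
    have hzX := chains_mono (stage_subset_fullSimplex w α) hz
    obtain ⟨h1, h2⟩ := exists_late_add_boundary hΘ (t := α) (critCoeffs F d T z)
      (fun K hK => (mem_stage.mp (hz K.1 hK).1).2) α
    set g := Θ.symm (lateCoords death Θ α (critCoeffs F d T z))
    refine ⟨critCycle hT g, critCycle_mem_chains hT reduced_subset_reducedSkeleton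
      (fun K hK => ⟨mem_reducedSkeleton.mpr ⟨(h1 K hK).1, Or.inr ⟨K.2, (h1 K hK).2⟩⟩,
        (h1 K hK).1⟩), boundary_critCycle hT g, ?_⟩
    refine (critCoeffs_mem_critBoundaries_iff hT (Submodule.sub_mem _ hzX
      (critCycle_mem_chains_fullSimplex hT g)) (by rw [map_sub, hz0, boundary_critCycle,
        sub_zero])).mp ?_
    rwa [map_sub, critCoeffs_critCycle]

include hT hΘ in
theorem isFitting_reducedSkeleton :
    IsFitting F d (reducedSkeleton w d T death α) (w.stage α) := by
  refine ⟨reducedSkeleton_subset_stage hT, fun i hi => ?_⟩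
  rcases hi.lt_or_eq with h | rfl
  · exact homMap_bijective_of_lt hT reduced_subset_reducedSkeleton
      (reducedSkeleton_subset_stage hT) (isSpanning_reducedSkeleton hT) h
  · exact homMap_reducedSkeleton_bijective hT hΘ

/-! ### Minimality -/

/-- The boundary of `c` is a cycle of `C` bounding in the stage, so by injectivity in degree `d - 1`
it bounds some `c₁` in `C`; surjectivity in degree `d` handles the cycle `c - c₁`. -/
theorem IsFitting.exists_eq_add_boundary {C : Finset (Finset P)}
    (hs : IsSpanning d C (w.stage α)) (hf : IsFitting F d C (w.stage α)) {c : Finset P → F}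
    (hc : c ∈ chains F d (w.stage α)) :
    ∃ c' ∈ chains F d C, ∃ b ∈ chains F (d + 1) (w.stage α), boundary F b = c - c' := by
  have hbc := boundary_mem_chains (isComplex_stage w α) hc
  have h1 : ∃ c₁ ∈ chains F d C, boundary F c₁ = boundary F c := by
    -- For `d = 0` fitting says nothing in degree `-1`, but there are no chains there either.
    cases d with
    | zero =>
      rw [chains_eq_bot (k := ((0 : ℕ) : ℤ) - 1) fun A hA h =>
        (Finset.card_pos.mpr (mem_stage.mp hA).1).ne' (by omega), Submodule.mem_bot] at hbc
      exact ⟨0, Submodule.zero_mem _, by rw [hbc, map_zero]⟩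
    | succ k =>
      have hk : ((k + 1 : ℕ) : ℤ) = (k : ℤ) + 1 := by push_cast; rfl
      rw [hk] at hc hbc ⊢
      rw [add_sub_cancel_right] at hbc
      exact (homMap_injective_iff hf.1).mp (hf.2 k (by omega)).1 _
        (mem_chains_of_isSpanning hs (by omega) hbc) (boundary_boundary c) ⟨c, hc, rfl⟩
  obtain ⟨c₁, hc₁, hb₁⟩ := h1
  obtain ⟨z, hz, -, b, hb, hbz⟩ := (homMap_surjective_iff hf.1).mp (hf.2 d le_rfl).2 (c - c₁)
    (Submodule.sub_mem _ hc (chains_mono hf.1 hc₁)) (by rw [map_sub, hb₁, sub_self])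
  exact ⟨c₁ + z, Submodule.add_mem _ hc₁ hz, b, hb, by rw [hbz]; abel⟩

variable (death Θ α) in
/-- The projection of the `d`-chains of the stage at `α` onto those of the reduced skeleton, modulo
boundaries. -/
noncomputable def skeletonProj : (Finset P → F) →ₗ[F] (Finset P → F) :=
  LinearMap.id - critCycle hT ∘ₗ
    (LinearMap.id - Θ.symm.toLinearMap ∘ₗ lateCoords death Θ α) ∘ₗ critCoeffs F d T

theorem skeletonProj_apply (v : Finset P → F) :
    skeletonProj death α Θ hT v = v - critCycle hT (critCoeffs F d T v -
      Θ.symm (lateCoords death Θ α (critCoeffs F d T v))) := rfl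

include hΘ in
theorem skeletonProj_mem_chains {t : ℝ} {v : Finset P → F} (hv : v ∈ chains F d (w.stage t)) :
    skeletonProj death α Θ hT v ∈ chains F d (w.stage t) := by
  have hw : ∀ K, critCoeffs F d T v K ≠ 0 → w.weight K.1 ≤ t := fun K hK =>
    (mem_stage.mp (hv K.1 hK).1).2
  refine Submodule.sub_mem _ hv (critCycle_mem_chains_stage hT fun K hK => ?_)
  by_cases h : critCoeffs F d T v K = 0
  · refine ((exists_late_add_boundary hΘ _ hw α).1 K fun h0 => hK ?_).1
    exact (congrArg₂ (· - ·) h h0).trans (sub_self 0)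
  · exact hw K h

include hΘ in
theorem skeletonProj_single {A : Finset P} (hA : A ∈ reducedSkeleton w d T death α) :
    skeletonProj death α Θ hT (Pi.single A 1) = Pi.single A 1 := by
  rw [skeletonProj_apply, late_eq_self hΘ, sub_self, map_zero, sub_zero]
  intro K hK
  obtain rfl : K.1 = A := by
    by_contra h
    exact hK (Pi.single_eq_of_ne (M := fun _ => F) h 1)
  exact ((mem_reducedSkeleton.mp hA).2.resolve_left (mem_critical.mp K.2).2).2

include hΘ in
theorem skeletonProj_boundary {b : Finset P → F} (hb : b ∈ chains F (d + 1) (w.stage α)) :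
    skeletonProj death α Θ hT (boundary F b) = 0 := by
  have h1 : lateCoords death Θ α (critCoeffs F d T (boundary F b)) = 0 :=
    (lateCoords_eq_zero_iff hΘ).mpr ⟨_, ⟨b, hb, rfl⟩, rfl⟩
  rw [skeletonProj_apply, h1, map_zero, sub_zero, critCycle_critCoeffs hT
    (chains_mono (stage_subset_fullSimplex w α) (boundary_mem_chains_stage hb))
    (boundary_boundary b), sub_self]

include hT hΘ in
/-- The `d`-faces of the reduced skeleton can be exchanged for heavier `d`-faces of any fitting
spanning subcomplex. -/
theorem exists_heavier_injection {C : Finset (Finset P)} (hs : IsSpanning d C (w.stage α))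
    (hf : IsFitting F d C (w.stage α)) :
    ∃ f : {A // A ∈ (reducedSkeleton w d T death α).filter fun A => ¬ A.card ≤ d} → Finset P,
      Function.Injective f ∧ ∀ A, f A ∈ C.filter (fun A => ¬ A.card ≤ d) ∧
        w.weight A.1 ≤ w.weight (f A) := by
  classical
  set κ := skeletonProj death α Θ hT with hκ
  let N : {A // A ∈ (reducedSkeleton w d T death α).filter fun A => ¬ A.card ≤ d} →
    Finset (Finset P) := fun A => C.filter fun S => S.card = d + 1 ∧ κ (Pi.single S 1) A.1 ≠ 0
  -- Hall's condition by dimension: modulo boundaries each face in `s` is a chain of `C`, so the `S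
  -- ∈ C` whose projections meet `s` have images spanning the functions on `s`, and there are at
  -- least `s.card` of them.
  have hall : ∀ s : Finset {A // A ∈ (reducedSkeleton w d T death α).filter
      fun A => ¬ A.card ≤ d}, s.card ≤ (s.biUnion N).card := by
    intro s
    let ψ : (Finset P → F) →ₗ[F] (s → F) := LinearMap.funLeft F F (fun a => a.1.1) ∘ₗ κ
    have htop : Submodule.span F
        (((s.biUnion N).image fun S => ψ (Pi.single S 1) : Finset (s → F)) : Set (s → F)) = ⊤ := by
      refine eq_top_iff.mpr fun g _ => mem_of_forall_single _ fun a _ => ?_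
      have ha := Finset.mem_filter.mp a.1.2
      have hdim := dimLE_reducedSkeleton hT a.1.1 ha.1
      have h1 : ψ (Pi.single a.1.1 1) = Pi.single a 1 := by
        funext x
        change κ (Pi.single a.1.1 1) x.1.1 = _
        rw [hκ, skeletonProj_single hT hΘ ha.1]
        by_cases h : x = a
        · subst h
          simp
        · rw [Pi.single_eq_of_ne (M := fun _ => F) h, Pi.single_eq_of_ne (M := fun _ => F)]
          exact fun h' => h (Subtype.ext (Subtype.ext h'))
      obtain ⟨c, hc, b, hb, hbc⟩ := hf.exists_eq_add_boundary hs
        (single_mem_chains (k := d) (reducedSkeleton_subset_stage hT ha.1) (by omega) (1 : F))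
      have h2 : ψ (Pi.single a.1.1 1) = ψ c := by
        rw [← sub_eq_zero, ← map_sub, ← hbc]
        change LinearMap.funLeft F F _ (κ (boundary F b)) = 0
        rw [hκ, skeletonProj_boundary hT hΘ hb, map_zero]
      rw [← h1, h2]
      refine map_mem_of_forall_single ψ _ fun S hS => ?_
      by_cases hSN : S ∈ s.biUnion N
      · exact Submodule.subset_span (Finset.mem_coe.mpr (Finset.mem_image_of_mem _ hSN))
      · have : ψ (Pi.single S 1) = 0 := by
          funext x
          by_contra hx
          refine hSN (Finset.mem_biUnion.mpr ⟨x.1, x.2, Finset.mem_filter.mpr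
            ⟨(hc S hS).1, by have := (hc S hS).2; omega, hx⟩⟩)
        rw [this]
        exact Submodule.zero_mem _
    have h1 := finrank_span_finset_le_card (R := F)
      ((s.biUnion N).image fun S => ψ (Pi.single S 1))
    rw [Set.finrank, htop, finrank_top, Module.finrank_fintype_fun_eq_card, Fintype.card_coe] at h1
    exact h1.trans Finset.card_image_le
  obtain ⟨f, hinj, hfN⟩ := (Finset.all_card_le_biUnion_card_iff_exists_injective N).mp hall
  refine ⟨f, hinj, fun A => ?_⟩
  obtain ⟨h1, h2, h3⟩ := Finset.mem_filter.mp (hfN A)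
  refine ⟨Finset.mem_filter.mpr ⟨h1, by omega⟩, ?_⟩
  -- The projection keeps `f A` inside the stage at its own weight, so every face occurring in its
  -- image, `A` in particular, is no heavier.
  have h4 := skeletonProj_mem_chains (α := α) hT hΘ (single_mem_chains (k := d) (mem_stage.mpr
    ⟨Finset.card_pos.mp (by omega), le_refl (w.weight (f A))⟩) (by omega) (1 : F))
  exact (mem_stage.mp (h4 A.1 h3).1).2

include hT hΘ in
theorem total_reducedSkeleton_le {C : Finset (Finset P)}
    (hs : IsSpanning d C (w.stage α)) (hf : IsFitting F d C (w.stage α)) :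
    w.total (reducedSkeleton w d T death α) ≤ w.total C := by
  classical
  obtain ⟨f, hinj, hfC⟩ := exists_heavier_injection hT hΘ hs hf
  rw [Weighting.total, Weighting.total, ← Finset.sum_filter_add_sum_filter_not _ (·.card ≤ d),
    ← Finset.sum_filter_add_sum_filter_not C (·.card ≤ d)]
  have h1 : (reducedSkeleton w d T death α).filter (·.card ≤ d) = C.filter (·.card ≤ d) := by
    ext A
    simp only [Finset.mem_filter]
    exact and_congr_left fun hA => (isSpanning_reducedSkeleton hT A hA).trans (hs A hA).symm
  rw [h1]
  refine add_le_add le_rfl ?_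
  refine (Finset.sum_coe_sort _ _).symm.le.trans ?_
  refine (Finset.sum_le_sum fun A _ => (hfC A).2).trans ?_
  rw [← Finset.sum_image (f := w.weight) (g := f) hinj.injOn]
  refine Finset.sum_le_sum_of_subset_of_nonneg (fun S hS => ?_) fun S hS _ => ?_
  · obtain ⟨A, -, rfl⟩ := Finset.mem_image.mp hS
    exact (hfC A).1
  · exact w.nonneg S (mem_stage.mp (hf.1 (Finset.mem_filter.mp hS).1)).1

/-! ### Correspondences with the dots -/

theorem critCycle_single_mem_relCycles {K : Crit d T} (hw : w.weight K.1 ≤ α)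
    (hd : (α : EReal) < death K.1) :
    critCycle hT (Pi.single K 1) ∈ relCycles F d (reducedSkeleton w d T death α) ∅ := by
  refine mem_relCycles_empty.mpr ⟨critCycle_mem_chains hT reduced_subset_reducedSkeleton
    fun L hL => ?_, boundary_critCycle hT _⟩
  obtain rfl : L = K := by
    by_contra h
    exact hL (Pi.single_eq_of_ne (M := fun _ => F) h 1)
  exact ⟨mem_reducedSkeleton.mpr ⟨hw, Or.inr ⟨L.2, hd⟩⟩, hw⟩

theorem relMap_critCycle_single {K : Crit d T} (hw : w.weight K.1 ≤ α)
    (hd : (α : EReal) < death K.1) :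
    relMap F d (reducedSkeleton w d T death α) ∅ (reducedSkeleton w d T death α)
        (w.reduced T α) (relClass F d (reducedSkeleton w d T death α) ∅
          (critCycle hT (Pi.single K 1))) =
      faceClass F d (reducedSkeleton w d T death α) (w.reduced T α) K.1 := by
  have hcyc := critCycle_single_mem_relCycles hT hw hd
  have hK : K.1 ∈ reducedSkeleton w d T death α := mem_reducedSkeleton.mpr ⟨hw, Or.inr ⟨K.2, hd⟩⟩
  rw [relMap_relClass subset_rfl (Finset.empty_subset _) hcyc, relClass_eq_relClass_iff
    (relCycles_mono subset_rfl (Finset.empty_subset _) hcyc)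
    (single_mem_relCycles hT hK (mem_critical.mp K.2).1 hw), mem_relBoundaries]
  refine ⟨0, Submodule.zero_mem _, ?_⟩
  have h := treeChain_spec hT K
  rw [critCycle_single, map_zero, sub_zero, sub_sub_cancel_left]
  exact Submodule.neg_mem _ fun A hA =>
    ⟨mem_reduced.mpr ⟨(h.1 A hA).1, (h.2.2 A hA).trans hw⟩, (h.1 A hA).2⟩

/-- Lifts of `[K]` are unique because the tree carries no `d`-cycles. Hence the lifts in an
arbitrary correspondence are known explicitly. -/
theorem eq_relClass_critCycle_single {K : Crit d T} (hw : w.weight K.1 ≤ α)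
    (hd : (α : EReal) < death K.1) {x : Homology F (d : ℤ) (reducedSkeleton w d T death α)}
    (hx : relMap F d (reducedSkeleton w d T death α) ∅ (reducedSkeleton w d T death α)
        (w.reduced T α) x =
      faceClass F d (reducedSkeleton w d T death α) (w.reduced T α) K.1) :
    x = relClass F d (reducedSkeleton w d T death α) ∅ (critCycle hT (Pi.single K 1)) := by
  obtain ⟨z, hz, rfl⟩ := exists_relClass_eq x
  have hK : K.1 ∈ reducedSkeleton w d T death α := mem_reducedSkeleton.mpr ⟨hw, Or.inr ⟨K.2, hd⟩⟩
  rw [relMap_relClass subset_rfl (Finset.empty_subset _) hz, relClass_eq_relClass_iff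
    (relCycles_mono subset_rfl (Finset.empty_subset _) hz)
    (single_mem_relCycles hT hK (mem_critical.mp K.2).1 hw), mem_relBoundaries] at hx
  obtain ⟨c, hc, h⟩ := hx
  rw [chains_succ_eq_bot (dimLE_reducedSkeleton hT), Submodule.mem_bot] at hc
  rw [hc, map_zero, sub_zero] at h
  have hz' := mem_relCycles_empty.mp hz
  congr 1
  refine eq_of_critCoeffs_eq hT (chains_mono ((reducedSkeleton_subset_stage hT).trans
    (stage_subset_fullSimplex w α)) hz'.1) (critCycle_mem_chains_fullSimplex hT _)
    (by rw [hz'.2, boundary_critCycle]) ?_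
  rw [critCoeffs_critCycle]
  funext L
  have h0 := apply_eq_zero_of_mem_chains h (A := L.1)
    fun hL => (mem_critical.mp L.2).2 (mem_reduced.mp hL).1
  rw [Pi.sub_apply, sub_eq_zero] at h0
  rw [critCoeffs_apply, h0]
  by_cases hLK : L = K
  · subst hLK
    simp
  · rw [Pi.single_eq_of_ne (M := fun _ => F) hLK, Pi.single_eq_of_ne (M := fun _ => F)]
    exact fun h' => hLK (Subtype.ext h')

include hT in
theorem exists_dotCorrespondence (hdeath : IsDeathAssignment F w d T death) :
    ∃ φ : DotCorrespondence F w d α (reducedSkeleton w d T death α) (w.reduced T α),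
      ∀ K, (φ.dot K).1.1 = label w T death K.1 := by
  obtain ⟨Θ, hΘ⟩ := hdeath.exists_isAdapted hT
  obtain ⟨ε, hε⟩ := exists_dotEquiv hΘ hT hdeath
  obtain ⟨gen, hgen, hcoord⟩ := exists_generators hΘ hT ε hε
  have hS : ∀ S : {S // S ∈ facesOff d (reducedSkeleton w d T death α) (w.reduced T α)},
      S.1 ∈ critical d T ∧ w.weight S.1 ≤ α ∧ (α : EReal) < death S.1 := fun S =>
    mem_facesOff_reducedSkeleton.mp S.2
  let κ : {S // S ∈ facesOff d (reducedSkeleton w d T death α) (w.reduced T α)} →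
      {K : Crit d T // (w.weight K.1 : EReal) < death K.1} := fun S =>
    ⟨⟨S.1, (hS S).1⟩, (EReal.coe_le_coe_iff.mpr (hS S).2.1).trans_lt (hS S).2.2⟩
  have halive : ∀ S, AliveAt (ε (κ S)).1 α := by
    intro S
    rw [hε, AliveAt]
    exact ⟨EReal.coe_le_coe_iff.mpr (hS S).2.1, (hS S).2.2⟩
  let dot : {S // S ∈ facesOff d (reducedSkeleton w d T death α) (w.reduced T α)} ≃
      {x : Dot F w d // AliveAt x.1 α} := Equiv.ofBijective (fun S => ⟨ε (κ S), halive S⟩) <| by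
    constructor
    · intro S S' h
      have h1 := ε.injective (Subtype.mk.inj h)
      exact Subtype.ext (Subtype.mk.inj (Subtype.mk.inj h1))
    · rintro ⟨x, hx⟩
      obtain ⟨K, rfl⟩ := ε.surjective x
      have hx' := hx
      rw [hε, AliveAt, EReal.coe_le_coe_iff] at hx'
      exact ⟨⟨K.1.1, mem_facesOff_reducedSkeleton.mpr ⟨K.1.2, hx'⟩⟩, rfl⟩
  refine ⟨⟨dot, fun S => relClass F d _ ∅ (critCycle hT (Pi.single (κ S).1 1)),
    fun S => relMap_critCycle_single hT (K := (κ S).1) (hS S).2.1 (hS S).2.2, gen, hgen,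
    fun S hmem => ?_⟩, fun S => ?_⟩
  · have hcyc := critCycle_single_mem_relCycles hT (K := (κ S).1) (hS S).2.1 (hS S).2.2
    have hsub := reducedSkeleton_subset_stage (α := α) (death := death) hT
    rw [homMap, relMap_relClass hsub subset_rfl hcyc] at hmem
    -- The generators of all other dots have coordinate `0` at this face, whereas the class of its
    -- cycle has coordinate `1` by `IsAdapted.apply_single`.
    have hle : Submodule.span F ((fun x : {x : Dot F w d // AliveAt x.1 α} => gen x.1 α) ''
        {x | x ≠ dot S}) ≤ LinearMap.ker (LinearMap.proj (κ S).1 ∘ₗ aliveCoords hΘ α) := by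
      rw [Submodule.span_le]
      rintro _ ⟨x, hx, rfl⟩
      rw [SetLike.mem_coe, LinearMap.mem_ker, LinearMap.comp_apply, hcoord x.1 α x.2,
        LinearMap.proj_apply]
      refine Pi.single_eq_of_ne (M := fun _ => F) (fun h => hx (Subtype.ext ?_)) 1
      change x.1 = ε (κ S)
      rw [Subtype.ext h, ε.apply_symm_apply]
    have h0 := hle hmem
    rw [LinearMap.mem_ker, LinearMap.comp_apply, LinearMap.proj_apply,
      aliveCoords_relClass hΘ (relCycles_mono hsub subset_rfl hcyc), critCoeffs_critCycle,
      lateCoords_apply, if_pos (hS S).2.2, hΘ.apply_single] at h0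
    exact one_ne_zero h0
  · change (ε (κ S)).1 = _
    rw [hε, label, if_neg (mem_critical.mp (hS S).1).2]

include hT in
-- The cycle of a face already lives in the stage at the weight of the face. Expanding its class
-- there and pushing forward to `α` involves only dots born by that weight, so a later dot would
-- have coefficient zero.
theorem DotCorrespondence.birth_le
    (φ : DotCorrespondence F w d α (reducedSkeleton w d T death α) (w.reduced T α))
    (S : {S // S ∈ facesOff d (reducedSkeleton w d T death α) (w.reduced T α)}) :
    (φ.dot S).1.1.1 ≤ (w.weight S.1 : EReal) := by
  obtain ⟨hc, hw, hd⟩ := mem_facesOff_reducedSkeleton.mp S.2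
  by_contra hlt
  refine φ.coeff_ne_zero S ?_
  have hsub := reducedSkeleton_subset_stage (α := α) (death := death) hT
  have hcyc := critCycle_mem_relCycles hT (t := w.weight S.1) (f := Pi.single ⟨S.1, hc⟩ (1 : F))
    (fun L hL => by
      obtain rfl : L = ⟨S.1, hc⟩ := by
        by_contra h
        exact hL (Pi.single_eq_of_ne (M := fun _ => F) h 1)
      exact le_rfl)
  rw [eq_relClass_critCycle_single hT (K := ⟨S.1, hc⟩) hw hd (φ.lift_spec S), homMap,
    relMap_relClass hsub subset_rfl (critCycle_single_mem_relCycles hT (K := ⟨S.1, hc⟩) hw hd),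
    ← relMap_relClass (stage_mono w hw) subset_rfl hcyc]
  have hmem : relClass F d (w.stage (w.weight S.1)) ∅ (critCycle hT (Pi.single ⟨S.1, hc⟩ 1)) ∈
      Submodule.span F (Set.range fun x : {x : Dot F w d // AliveAt x.1 (w.weight S.1)} =>
        φ.gen x.1 (w.weight S.1)) := by
    rw [φ.isDecomposition.span_eq_top]
    exact Submodule.mem_top
  have hle : Submodule.span F (Set.range fun x : {x : Dot F w d // AliveAt x.1 (w.weight S.1)} =>
        φ.gen x.1 (w.weight S.1)) ≤ (Submodule.span F
      ((fun x : {x : Dot F w d // AliveAt x.1 α} => φ.gen x.1 α) '' {x | x ≠ φ.dot S})).comap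
        (homMap F d (w.stage (w.weight S.1)) (w.stage α)) := by
    rw [Submodule.span_le]
    rintro _ ⟨x, rfl⟩
    rw [SetLike.mem_coe, Submodule.mem_comap, φ.isDecomposition.map_eq x.1 _ _ x.2.1 hw]
    by_cases hx : AliveAt x.1.1 α
    · refine Submodule.subset_span ⟨⟨x.1, hx⟩, fun h => hlt ?_, rfl⟩
      rw [← h]
      exact x.2.1
    · rw [φ.isDecomposition.eq_zero _ _ hx]
      exact Submodule.zero_mem _
  exact hle hmem

include hT in
theorem DotCorrespondence.birth_eq (hdeath : IsDeathAssignment F w d T death)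
    (φ : DotCorrespondence F w d α (reducedSkeleton w d T death α) (w.reduced T α))
    (S : {S // S ∈ facesOff d (reducedSkeleton w d T death α) (w.reduced T α)}) :
    (φ.dot S).1.1.1 = (w.weight S.1 : EReal) := by
  obtain ⟨φ₀, hφ₀⟩ := exists_dotCorrespondence (α := α) hT hdeath
  have hbirth : ∀ K, (φ₀.dot K).1.1.1 = (w.weight K.1 : EReal) := by
    intro K
    rw [hφ₀, label]
    split_ifs <;> rfl
  -- Compared with the correspondence by labels, `φ` permutes the faces by `σ` without ever
  -- increasing the weight; since a permutation preserves the total weight, each of these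
  -- inequalities is an equality.
  let σ := φ.dot.trans φ₀.dot.symm
  have hσ : ∀ K, (φ.dot K).1.1.1 = (w.weight (σ K).1 : EReal) := by
    intro K
    rw [← hbirth]
    simp [σ]
  have hle : ∀ K ∈ Finset.univ, w.weight (σ K).1 ≤ w.weight K.1 := fun K _ => by
    have := φ.birth_le hT K
    rwa [hσ, EReal.coe_le_coe_iff] at this
  have heq := (Finset.sum_eq_sum_iff_of_le hle).mp (Equiv.sum_comp σ fun K => w.weight K.1)
  rw [hσ, heq S (Finset.mem_univ S)]

end ReducedSkeleton

end HomPersSkeleton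

theorem mainTheorem1 {F : Type*} [Field F] {P : Type*} [Fintype P] [LinearOrder P] [Nonempty P]
    (w : HomPersSkeleton.Weighting P) (d : ℕ) (α : ℝ)
    (T : Finset (Finset P)) (hT : HomPersSkeleton.IsMinSpanningTree F w d T)
    (death : Finset P → EReal) (hdeath : HomPersSkeleton.IsDeathAssignment F w d T death) :
    -- the reduced skeleton is a `d`-spanning subcomplex of dimension at most `d`, and `d`-fitting
    (HomPersSkeleton.IsComplex (HomPersSkeleton.reducedSkeleton w d T death α) ∧
      HomPersSkeleton.DimLE d (HomPersSkeleton.reducedSkeleton w d T death α) ∧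
      HomPersSkeleton.IsSpanning d (HomPersSkeleton.reducedSkeleton w d T death α) (w.stage α) ∧
      HomPersSkeleton.IsFitting F d (HomPersSkeleton.reducedSkeleton w d T death α) (w.stage α)) ∧
    -- the labels of the critical faces give a correspondence with the dots alive at `α`
    (∃ φ : HomPersSkeleton.DotCorrespondence F w d α
        (HomPersSkeleton.reducedSkeleton w d T death α) (w.reduced T α),
      ∀ K, (φ.dot K).1.1 = HomPersSkeleton.label w T death K.1) ∧
    -- in every such correspondence the first coordinate of the dot is the weight of the face
    (∀ φ : HomPersSkeleton.DotCorrespondence F w d α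
        (HomPersSkeleton.reducedSkeleton w d T death α) (w.reduced T α),
      ∀ K, (φ.dot K).1.1.1 = (w.weight K.1 : EReal)) ∧
    -- the reduced skeleton has the minimal total weight
    (∀ C : Finset (Finset P), HomPersSkeleton.IsComplex C →
      HomPersSkeleton.IsSpanning d C (w.stage α) → HomPersSkeleton.IsFitting F d C (w.stage α) →
      w.total (HomPersSkeleton.reducedSkeleton w d T death α) ≤ w.total C) := by
  obtain ⟨Θ, hΘ⟩ := hdeath.exists_isAdapted hT
  exact ⟨⟨HomPersSkeleton.isComplex_reducedSkeleton hT, HomPersSkeleton.dimLE_reducedSkeleton hT,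
      HomPersSkeleton.isSpanning_reducedSkeleton hT,
      HomPersSkeleton.isFitting_reducedSkeleton hT hΘ⟩,
    HomPersSkeleton.exists_dotCorrespondence hT hdeath,
    fun φ K => φ.birth_eq hT hdeath K,
    fun _ _ hs hf => HomPersSkeleton.total_reducedSkeleton_le hT hΘ hs hf⟩
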